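/- Let $\mathbb B$ be the split quaternions, with basis $1,\mathbf i,\mathbf s,\mathbf t$ and $\mathbf i^2=-1$, $\mathbf s^2=\mathbf t^2=1$, $\mathbf i\mathbf s=\mathbf t=-\mathbf s\mathbf i$; put $\langle p,q\rangle=\operatorname{Re}(p\bar q)$, $\|q\|^2=\langle q,q\rangle$ (indefinite), $\mathrm{Sp}(1,\mathbb B)=\{q:\ q\bar q=1\}$ and $\mathfrak{sp}(1,\mathbb B)=\operatorname{Im}\mathbb B$. Let $(M,g,I,S,T)$ be a hypersymplectic manifold of dimension $4n$: $g$ is a smooth pseudo-Riemannian metric of signature $(2n,2n)$, $I,S,T$ are smooth endomorphism fields of $TM$ with $I^2=-1$, $S^2=T^2=1$, $IS=T=-SI$, $TS=I$, $g(I\cdot,I\cdot)=g$, $g(S\cdot,S\cdot)=g(T\cdot,T\cdot)=-g$, and the forms $\omega_1=g(I\cdot,\cdot)$, $\omega_2=g(S\cdot,\cdot)$, $\omega_3=g(T\cdot,\cdot)$ are closed. For $\xi=\xi_1\mathbf i+\xi_2\mathbf s+\xi_3\mathbf t$ put $\mathbb I_\xi=\xi_1I+\xi_2S+\xi_3T$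 and $\omega_\xi=g(\mathbb I_\xi\cdot,\cdot)$. Let $\mathrm{Sp}(1,\mathbb B)$ act on $M$ smoothly, freely, isometrically, and permuting, i.e. $q_*\,\mathbb I_\xi\,q_*^{-1}=\mathbb I_{q\xi\bar q}$ for all $q\in \mathrm{Sp}(1,\mathbb B)$, $\xi\in\operatorname{Im}\mathbb B$. Let $K_\xi(x)=\frac{d}{dt}\big|_{t=0}\exp(t\xi)\cdot x$. For a bilinear map $\beta$ on $\operatorname{Im}\mathbb B$ let $\operatorname{tr}\beta=\beta(\mathbf i,\mathbf i)-\beta(\mathbf s,\mathbf s)-\beta(\mathbf t,\mathbf t)$ be its trace with respect to $\langle\cdot,\cdot\rangle$. Define vector fields $$\mathcal X(\xi,\xi')=\mathbb I_\xi K_{\xi'},\qquad E=\mathcal X_0=-\tfrac13\operatorname{tr}\mathcal X,\qquad \mathcal X_2(\xi,\xi')=-\langle\xi,\xi'\rangle\mathcal X_0-\tfrac12\big(\mathbb I_\xi K_{\xi'}+\mathbb I_{\xi'}K_\xi\big).$$ Let $\gamma(\xi,\xi')=\frac12\,\iota_{K_{\xi'}}\omega_\xi$, let $\gamma_1$ be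 the $(\operatorname{Im}\mathbb B)^*$-valued $1$-form determined by $\gamma_1\big(\tfrac12[\xi,\xi']\big)=\frac12\big(\gamma(\xi,\xi')-\gamma(\xi',\xi)\big)$, let $\rho(\xi,\xi')=\iota_{K_{\xi'}}\gamma_1(\xi)$, let $\rho_0=\frac13\operatorname{tr}\rho$, and let $\rho_2(\xi,\xi')=\frac12\big(\rho(\xi,\xi')+\rho(\xi',\xi)\big)-\langle\xi,\xi'\rangle\rho_0$ be the trace-free symmetric part of $\rho$. Then $\mathcal X_2=0$ if and only if $\rho_2=0$. If this holds, then: 1. $\rho_0$ is a hypersymplectic potential: it is smooth and $\frac12\,d(J\,d\rho_0)=g(J\cdot,\cdot)$ for each of $J=I,S,T$, where $(J\alpha)(v):=-\alpha(Jv)$ for a $1$-form $\alpha$. 2. $E=-\|\xi\|^{-2}\,\mathbb I_\xi K_\xi$ for every $\xi\in\operatorname{Im}\mathbb B$ with $\|\xi\|^2\ne0$. In particular $E=-\mathbb I_\xi K_\xi$ for all $\xi$ with $\|\xi\|^2=1$, and $E=\mathbb I_\xi K_\xi$ for all $\xi$ with $\|\xi\|^2=-1$. 3. $g(E,E)=2\rho_0$,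 and $g(K_\xi,K_\xi)=2\|\xi\|^2\rho_0$ for all $\xi\in\operatorname{Im}\mathbb B$. In particular $\rho_0>0$ exactly at the points where $K_{\mathbf i}$ is spacelike. -/

import Mathlib

open scoped Manifold ContDiff Topology
open Bundle

noncomputable section

/-- The split quaternions: `i ^ 2 = -1`, `j ^ 2 = 1 = k ^ 2`, `i * j = k`. The imaginary units
`i, s, t` are Mathlib's `i, j, k`. -/
abbrev SplitQuaternion : Type := QuaternionAlgebra ℝ (-1) 0 1

namespace SplitQuaternion

/-! ### The topology of the four dimensional algebra
An auxiliary (submultiplicative) norm; it only serves to fix the usual topology and smooth structure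
of this real vector space, and is not the indefinite quadratic form `nsq` below. -/

instance : NormedAddCommGroup SplitQuaternion :=
  AddGroupNorm.toNormedAddCommGroup
    { toFun := fun q => |q.re| + |q.imI| + |q.imJ| + |q.imK|
      map_zero' := by simp
      add_le' := fun p q => by
        have h1 := abs_add_le p.re q.re
        have h2 := abs_add_le p.imI q.imI
        have h3 := abs_add_le p.imJ q.imJ
        have h4 := abs_add_le p.imK q.imK
        simp only [QuaternionAlgebra.re_add, QuaternionAlgebra.imI_add,
          QuaternionAlgebra.imJ_add, QuaternionAlgebra.imK_add]
        linarith
      neg' := fun q => by simp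
      eq_zero_of_map_eq_zero' := fun q hq => by
        have hq' : |q.re| + |q.imI| + |q.imJ| + |q.imK| = 0 := hq
        have h1 := abs_nonneg q.re
        have h2 := abs_nonneg q.imI
        have h3 := abs_nonneg q.imJ
        have h4 := abs_nonneg q.imK
        ext
        · exact abs_eq_zero.1 (by linarith)
        · exact abs_eq_zero.1 (by linarith)
        · exact abs_eq_zero.1 (by linarith)
        · exact abs_eq_zero.1 (by linarith) }

theorem norm_def (q : SplitQuaternion) : ‖q‖ = |q.re| + |q.imI| + |q.imJ| + |q.imK| := rfl

theorem abs_four_le (a b c d : ℝ) : |a + b + c + d| ≤ |a| + |b| + |c| + |d| := by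
  have h1 := abs_add_le (a + b + c) d
  have h2 := abs_add_le (a + b) c
  have h3 := abs_add_le a b
  linarith

theorem norm_mul_le_aux (p q : SplitQuaternion) : ‖p * q‖ ≤ ‖p‖ * ‖q‖ := by
  have h1 := abs_four_le (p.re * q.re) (-(p.imI * q.imI)) (p.imJ * q.imJ) (p.imK * q.imK)
  have h2 := abs_four_le (p.re * q.imI) (p.imI * q.re) (-(p.imJ * q.imK)) (p.imK * q.imJ)
  have h3 := abs_four_le (p.re * q.imJ) (-(p.imI * q.imK)) (p.imJ * q.re) (p.imK * q.imI)
  have h4 := abs_four_le (p.re * q.imK) (p.imI * q.imJ) (-(p.imJ * q.imI)) (p.imK * q.re)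
  have e1 : (p * q).re = p.re * q.re + -(p.imI * q.imI) + p.imJ * q.imJ + p.imK * q.imK := by
    simp
  have e2 : (p * q).imI = p.re * q.imI + p.imI * q.re + -(p.imJ * q.imK) + p.imK * q.imJ := by
    simp [sub_eq_add_neg]
  have e3 : (p * q).imJ = p.re * q.imJ + -(p.imI * q.imK) + p.imJ * q.re + p.imK * q.imI := by
    simp [sub_eq_add_neg]
  have e4 : (p * q).imK = p.re * q.imK + p.imI * q.imJ + -(p.imJ * q.imI) + p.imK * q.re := by
    simp [sub_eq_add_neg]
  rw [← e1] at h1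
  rw [← e2] at h2
  rw [← e3] at h3
  rw [← e4] at h4
  simp only [norm_def, abs_neg, abs_mul] at *
  nlinarith

instance : NormedRing SplitQuaternion where
  dist_eq := fun p q => dist_eq_norm_neg_add p q
  norm_mul_le := norm_mul_le_aux

instance : NormedAlgebra ℝ SplitQuaternion where
  norm_smul_le := fun r q => by
    simp only [norm_def, QuaternionAlgebra.re_smul, QuaternionAlgebra.imI_smul,
      QuaternionAlgebra.imJ_smul, QuaternionAlgebra.imK_smul, smul_eq_mul, abs_mul,
      Real.norm_eq_abs]
    apply le_of_eq
    ring

instance : CompleteSpace SplitQuaternion := FiniteDimensional.complete ℝ SplitQuaternion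

instance : ContinuousStar SplitQuaternion where
  continuous_star := by
    have h : LipschitzWith 1 (star : SplitQuaternion → SplitQuaternion) := by
      refine LipschitzWith.of_dist_le_mul fun p q => ?_
      rw [dist_eq_norm, dist_eq_norm, ← star_sub]
      have e1 : |-p.imI + q.imI| = |p.imI - q.imI| := by rw [← abs_neg]; congr 1; ring
      have e2 : |-p.imJ + q.imJ| = |p.imJ - q.imJ| := by rw [← abs_neg]; congr 1; ring
      have e3 : |-p.imK + q.imK| = |p.imK - q.imK| := by rw [← abs_neg]; congr 1; ring
      simp [norm_def, e1, e2, e3]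
    exact h.continuous

instance : StarModule ℝ SplitQuaternion where
  star_smul := fun r q => by ext <;> simp

/-- The inner product `⟨p, q⟩ = Re (p * conj q)`, of signature `(2, 2)`. -/
def bform (p q : SplitQuaternion) : ℝ := (p * star q).re

/-- The indefinite norm-square `⟨q, q⟩ = q₀ ^ 2 + q₁ ^ 2 - q₂ ^ 2 - q₃ ^ 2`. -/
def nsq (q : SplitQuaternion) : ℝ := bform q q

end SplitQuaternion

/-- The group `Sp(1, 𝔹)` of split quaternions `q` with `q * conj q = 1`. -/
abbrev SpOne : Type := unitary SplitQuaternion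

/-- The Lie algebra `sp(1, 𝔹) = Im 𝔹` of split quaternions `ξ` with `conj ξ = -ξ`. -/
abbrev ImSplit : Type := skewAdjoint SplitQuaternion

namespace ImSplit

/-! The basis `i, s, t` of `Im 𝔹`. -/

def i : ImSplit := ⟨⟨0, 1, 0, 0⟩, by rw [skewAdjoint.mem_iff]; ext <;> simp⟩
def s : ImSplit := ⟨⟨0, 0, 1, 0⟩, by rw [skewAdjoint.mem_iff]; ext <;> simp⟩
def t : ImSplit := ⟨⟨0, 0, 0, 1⟩, by rw [skewAdjoint.mem_iff]; ext <;> simp⟩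

/-- The inner product of `𝔹` restricted to `Im 𝔹`. -/
def bform (ξ η : ImSplit) : ℝ := SplitQuaternion.bform ξ η

/-- The norm-square on `Im 𝔹`, of signature `(1, 2)`. -/
def nsq (ξ : ImSplit) : ℝ := SplitQuaternion.nsq ξ

/-- The adjoint action `ξ ↦ q ξ q⁻¹ = q ξ (conj q)` of `Sp(1, 𝔹)`; it is the standard action
of `SO⁺(1, 2)` on `Im 𝔹`. -/
def Ad (q : SpOne) (ξ : ImSplit) : ImSplit :=
  ⟨(q : SplitQuaternion) * ξ * star (q : SplitQuaternion), skewAdjoint.conjugate ξ.2 _⟩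

/-- The exponential map `sp(1, 𝔹) → Sp(1, 𝔹)`. -/
def expo (ξ : ImSplit) : SpOne :=
  ⟨NormedSpace.exp (ξ : SplitQuaternion), by
    let _ : NormedAlgebra ℚ SplitQuaternion := NormedAlgebra.restrictScalars ℚ ℝ SplitQuaternion
    exact NormedSpace.exp_mem_unitary_of_mem_skewAdjoint ξ.2⟩

/-- The trace of a bilinear map on `Im 𝔹` with respect to the inner product, i.e.
`∑ β(eₐ, eᵃ)` for the basis `i, s, t` and its dual basis `i, -s, -t`. -/
def tr {V : Type*} [AddCommGroup V] (β : ImSplit → ImSplit → V) : V := β i i - β s s - β t t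

end ImSplit

/-! ### Differential forms -/

/-- An alternating bilinear form as a continuous alternating map. -/
def twoFormOf {V : Type*} [NormedAddCommGroup V] [NormedSpace ℝ V]
    (B : V →L[ℝ] V →L[ℝ] ℝ) (hB : ∀ v, B v v = 0) : V [⋀^Fin 2]→L[ℝ] ℝ where
  toFun v := B (v 0) (v 1)
  map_update_add' := by
    intro _ v k x y
    fin_cases k <;> simp
  map_update_smul' := by
    intro _ v k c x
    fin_cases k <;> simp
  map_eq_zero_of_eq' := by
    intro v k l h hkl
    have h01 : v 0 = v 1 := by
      fin_cases k <;> fin_cases l <;> simp_all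
    simp [h01, hB]
  cont := by fun_prop

section Manifold

variable {E : Type*} [NormedAddCommGroup E] [NormedSpace ℝ E]
  {M : Type*} [TopologicalSpace M] [ChartedSpace E M]

/-- The exterior derivative of a differential `p`-form on a manifold: transport to the preferred
chart at `x`, take the exterior derivative there, and pull back. -/
def mExtDeriv {p : ℕ} (α : ∀ x : M, TangentSpace 𝓘(ℝ, E) x [⋀^Fin p]→L[ℝ] ℝ) (x : M) :
    TangentSpace 𝓘(ℝ, E) x [⋀^Fin (p + 1)]→L[ℝ] ℝ :=
  ContinuousAlternatingMap.compContinuousLinearMap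
    (extDeriv (E := E) (fun y : E =>
      ContinuousAlternatingMap.compContinuousLinearMap (α ((extChartAt 𝓘(ℝ, E) x).symm y))
        (mfderiv 𝓘(ℝ, E) 𝓘(ℝ, E) (extChartAt 𝓘(ℝ, E) x).symm y))
      (extChartAt 𝓘(ℝ, E) x x))
    (mfderiv 𝓘(ℝ, E) 𝓘(ℝ, E) (extChartAt 𝓘(ℝ, E) x) x)

end Manifold

/-! ### Hypersymplectic manifolds -/

/-- A smooth split quaternionic structure `I, S, T` together with a compatible smooth
pseudo-Riemannian metric `g` of signature `(2n, 2n)`, on a manifold modelled on `E`. -/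
structure AlmostHypersymplectic (n : ℕ) (E : Type*) [NormedAddCommGroup E] [NormedSpace ℝ E]
    (M : Type*) [TopologicalSpace M] [ChartedSpace E M] [IsManifold 𝓘(ℝ, E) ∞ M] where
  g : ∀ x : M, TangentSpace 𝓘(ℝ, E) x →L[ℝ] TangentSpace 𝓘(ℝ, E) x →L[ℝ] ℝ
  I : ∀ x : M, TangentSpace 𝓘(ℝ, E) x →L[ℝ] TangentSpace 𝓘(ℝ, E) x
  S : ∀ x : M, TangentSpace 𝓘(ℝ, E) x →L[ℝ] TangentSpace 𝓘(ℝ, E) x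
  T : ∀ x : M, TangentSpace 𝓘(ℝ, E) x →L[ℝ] TangentSpace 𝓘(ℝ, E) x
  smooth_g : ContMDiff 𝓘(ℝ, E) (𝓘(ℝ, E).prod 𝓘(ℝ, E →L[ℝ] E →L[ℝ] ℝ)) ∞
    (fun x => TotalSpace.mk' (E →L[ℝ] E →L[ℝ] ℝ)
      (E := fun x : M => TangentSpace 𝓘(ℝ, E) x →L[ℝ] TangentSpace 𝓘(ℝ, E) x →L[ℝ] ℝ) x (g x))
  smooth_I : ContMDiff 𝓘(ℝ, E) (𝓘(ℝ, E).prod 𝓘(ℝ, E →L[ℝ] E)) ∞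
    (fun x => TotalSpace.mk' (E →L[ℝ] E)
      (E := fun x : M => TangentSpace 𝓘(ℝ, E) x →L[ℝ] TangentSpace 𝓘(ℝ, E) x) x (I x))
  smooth_S : ContMDiff 𝓘(ℝ, E) (𝓘(ℝ, E).prod 𝓘(ℝ, E →L[ℝ] E)) ∞
    (fun x => TotalSpace.mk' (E →L[ℝ] E)
      (E := fun x : M => TangentSpace 𝓘(ℝ, E) x →L[ℝ] TangentSpace 𝓘(ℝ, E) x) x (S x))
  smooth_T : ContMDiff 𝓘(ℝ, E) (𝓘(ℝ, E).prod 𝓘(ℝ, E →L[ℝ] E)) ∞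
    (fun x => TotalSpace.mk' (E →L[ℝ] E)
      (E := fun x : M => TangentSpace 𝓘(ℝ, E) x →L[ℝ] TangentSpace 𝓘(ℝ, E) x) x (T x))
  symm : ∀ x u v, g x u v = g x v u
  neutral : ∀ x, ∃ P N : Submodule ℝ (TangentSpace 𝓘(ℝ, E) x), IsCompl P N ∧
    Module.finrank ℝ P = 2 * n ∧ Module.finrank ℝ N = 2 * n ∧
    (∀ u ∈ P, u ≠ 0 → 0 < g x u u) ∧ (∀ u ∈ N, u ≠ 0 → g x u u < 0)
  I_I : ∀ x u, I x (I x u) = -u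
  S_S : ∀ x u, S x (S x u) = u
  T_T : ∀ x u, T x (T x u) = u
  I_S : ∀ x u, I x (S x u) = T x u
  S_I : ∀ x u, S x (I x u) = -T x u
  T_S : ∀ x u, T x (S x u) = I x u
  g_I : ∀ x u v, g x (I x u) (I x v) = g x u v
  g_S : ∀ x u v, g x (S x u) (S x v) = -g x u v
  g_T : ∀ x u v, g x (T x u) (T x v) = -g x u v

namespace AlmostHypersymplectic

variable {n : ℕ} {E : Type*} [NormedAddCommGroup E] [NormedSpace ℝ E]
  {M : Type*} [TopologicalSpace M] [ChartedSpace E M] [IsManifold 𝓘(ℝ, E) ∞ M]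
  (h : AlmostHypersymplectic n E M)

/-- The endomorphism field `𝕀_ξ = ξ₁ I + ξ₂ S + ξ₃ T`. -/
def str (ξ : ImSplit) (x : M) : TangentSpace 𝓘(ℝ, E) x →L[ℝ] TangentSpace 𝓘(ℝ, E) x :=
  (ξ : SplitQuaternion).imI • h.I x + (ξ : SplitQuaternion).imJ • h.S x +
    (ξ : SplitQuaternion).imK • h.T x

theorem g_str_self (ξ : ImSplit) (x : M) (v : TangentSpace 𝓘(ℝ, E) x) :
    h.g x (h.str ξ x v) v = 0 := by
  have h1 : h.g x (h.I x v) v = 0 := by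
    have a := h.g_I x (h.I x v) v
    rw [h.I_I, map_neg, neg_apply, h.symm x v] at a
    linarith
  have h2 : h.g x (h.S x v) v = 0 := by
    have a := h.g_S x (h.S x v) v
    rw [h.S_S, h.symm x v] at a
    linarith
  have h3 : h.g x (h.T x v) v = 0 := by
    have a := h.g_T x (h.T x v) v
    rw [h.T_T, h.symm x v] at a
    linarith
  simp [str, h1, h2, h3]

/-- The 2-form `ω_ξ(u, v) = g(𝕀_ξ u, v)`. -/
def fundForm (ξ : ImSplit) (x : M) : TangentSpace 𝓘(ℝ, E) x [⋀^Fin 2]→L[ℝ] ℝ :=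
  twoFormOf (V := E) ((h.g x).comp (h.str ξ x)) (h.g_str_self ξ x)

end AlmostHypersymplectic

/-- A hypersymplectic structure: the three 2-forms
`ω₁ = g(I·, ·)`, `ω₂ = g(S·, ·)`, `ω₃ = g(T·, ·)` are closed. -/
structure Hypersymplectic (n : ℕ) (E : Type*) [NormedAddCommGroup E] [NormedSpace ℝ E]
    (M : Type*) [TopologicalSpace M] [ChartedSpace E M] [IsManifold 𝓘(ℝ, E) ∞ M] extends
    AlmostHypersymplectic n E M where
  closed_I : ∀ x, mExtDeriv (toAlmostHypersymplectic.fundForm ImSplit.i) x = 0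
  closed_S : ∀ x, mExtDeriv (toAlmostHypersymplectic.fundForm ImSplit.s) x = 0
  closed_T : ∀ x, mExtDeriv (toAlmostHypersymplectic.fundForm ImSplit.t) x = 0

namespace Hypersymplectic

variable {n : ℕ} {E : Type*} [NormedAddCommGroup E] [NormedSpace ℝ E]
  {M : Type*} [TopologicalSpace M] [ChartedSpace E M] [IsManifold 𝓘(ℝ, E) ∞ M]

/-- `ρ` is a (para-)Kähler potential for the endomorphism field `J` with 2-form `σ`: `ρ` is smooth
and `(1/2) d (J dρ) = σ`, where `(J α)(v) = -α(J v)` for a 1-form `α`. -/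
def IsPotentialFor (J : ∀ x : M, TangentSpace 𝓘(ℝ, E) x →L[ℝ] TangentSpace 𝓘(ℝ, E) x)
    (σ : ∀ x : M, TangentSpace 𝓘(ℝ, E) x [⋀^Fin 2]→L[ℝ] ℝ) (ρ : M → ℝ) : Prop :=
  ContMDiff 𝓘(ℝ, E) 𝓘(ℝ, ℝ) ∞ ρ ∧
  ∀ x, (1 / 2 : ℝ) • mExtDeriv (fun y : M =>
    ContinuousAlternatingMap.ofSubsingleton ℝ (TangentSpace 𝓘(ℝ, E) y) ℝ (0 : Fin 1)
      (-((show TangentSpace 𝓘(ℝ, E) y →L[ℝ] ℝ from mfderiv 𝓘(ℝ, E) 𝓘(ℝ, ℝ) ρ y).comp (J y)))) x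
    = σ x

variable (h : Hypersymplectic n E M)

/-- `ρ` is simultaneously a potential for `I`, `S` and `T`. -/
def IsHypersymplecticPotential (ρ : M → ℝ) : Prop :=
  IsPotentialFor h.I (h.fundForm ImSplit.i) ρ ∧
  IsPotentialFor h.S (h.fundForm ImSplit.s) ρ ∧
  IsPotentialFor h.T (h.fundForm ImSplit.t) ρ

variable [MulAction SpOne M]

/-- The differential of the action of `q` at `x`. -/
def dAct (E : Type*) [NormedAddCommGroup E] [NormedSpace ℝ E] {M : Type*} [TopologicalSpace M]
    [ChartedSpace E M] [MulAction SpOne M] (q : SpOne) (x : M) :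
    TangentSpace 𝓘(ℝ, E) x →L[ℝ] TangentSpace 𝓘(ℝ, E) (q • x) :=
  mfderiv 𝓘(ℝ, E) 𝓘(ℝ, E) (fun y : M => q • y) x

/-- A smooth isometric action of `Sp(1, 𝔹)` is permuting if it acts on the endomorphisms `𝕀_ξ` by
the standard action of `SO⁺(1, 2)`: `q_* 𝕀_ξ (q_*)⁻¹ = 𝕀_{Ad_q ξ}`. -/
structure IsPermutingAction : Prop where
  /-- `Sp(1, 𝔹) × M → M` is smooth, where `Sp(1, 𝔹)` is a submanifold of the vector space `𝔹`:
  near every point it is the restriction of a smooth map on an open set of `𝔹 × M`. -/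
  smooth : ∀ (q₀ : SpOne) (x₀ : M), ∃ (F : SplitQuaternion × M → M) (U : Set (SplitQuaternion × M)),
    IsOpen U ∧ ((q₀ : SplitQuaternion), x₀) ∈ U ∧
    ContMDiffOn (𝓘(ℝ, SplitQuaternion).prod 𝓘(ℝ, E)) 𝓘(ℝ, E) ∞ F U ∧
    ∀ (q : SpOne) (x : M), ((q : SplitQuaternion), x) ∈ U → F ((q : SplitQuaternion), x) = q • x
  isometric : ∀ (q : SpOne) (x : M) (u v : TangentSpace 𝓘(ℝ, E) x),
    h.g (q • x) (dAct E q x u) (dAct E q x v) = h.g x u v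
  permuting : ∀ (q : SpOne) (ξ : ImSplit) (x : M) (u : TangentSpace 𝓘(ℝ, E) x),
    dAct E q x (h.str ξ x u) = h.str (ImSplit.Ad q ξ) (q • x) (dAct E q x u)

/-- The fundamental vector field `K_ξ(x) = d/dt exp(t ξ) • x` at `t = 0`. -/
def fundVF (E : Type*) [NormedAddCommGroup E] [NormedSpace ℝ E] {M : Type*} [TopologicalSpace M]
    [ChartedSpace E M] [MulAction SpOne M] (ξ : ImSplit) (x : M) : TangentSpace 𝓘(ℝ, E) x :=
  show E from mfderiv 𝓘(ℝ, ℝ) 𝓘(ℝ, E) (fun t : ℝ => ImSplit.expo (t • ξ) • x) 0 (1 : ℝ)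

/-- `X(ξ, η) = 𝕀_ξ K_η`. -/
def X (ξ η : ImSplit) (x : M) : TangentSpace 𝓘(ℝ, E) x := h.str ξ x (fundVF E η x)

/-- The vector field `X₀ = -(1/3) tr X`. -/
def X₀ (x : M) : TangentSpace 𝓘(ℝ, E) x := -(1 / 3 : ℝ) • ImSplit.tr (fun ξ η => h.X ξ η x)

/-- `X₂(ξ, η) = -X₀ ⟨ξ, η⟩ - (1/2) (𝕀_ξ K_η + 𝕀_η K_ξ)`, minus the trace-free symmetric part
of `X`. -/
def X₂ (ξ η : ImSplit) (x : M) : TangentSpace 𝓘(ℝ, E) x :=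
  -(ImSplit.bform ξ η • h.X₀ x) - (1 / 2 : ℝ) • (h.X ξ η x + h.X η ξ x)

/-- The 1-forms `γ(ξ, η) = (1/2) ι_{K_η} ω_ξ = (1/2) g(𝕀_ξ K_η, ·)`. -/
def γ (ξ η : ImSplit) (x : M) : TangentSpace 𝓘(ℝ, E) x →L[ℝ] ℝ :=
  (1 / 2 : ℝ) • h.g x (h.X ξ η x)

/-- The alternating part of `γ`. -/
def altγ (ξ η : ImSplit) (x : M) : TangentSpace 𝓘(ℝ, E) x →L[ℝ] ℝ :=
  (1 / 2 : ℝ) • (h.γ ξ η x - h.γ η ξ x)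

/-- The `Im 𝔹`-dual-valued 1-form `γ₁`, the alternating part of `γ` read through the isomorphism
`Λ² (Im 𝔹) ≅ Im 𝔹`, `ξ ∧ η ↦ (1/2) [ξ, η]`, which sends
`s ∧ t ↦ -i`, `t ∧ i ↦ s`, `i ∧ s ↦ t`. -/
def γ₁ (ζ : ImSplit) (x : M) : TangentSpace 𝓘(ℝ, E) x →L[ℝ] ℝ :=
  -((ζ : SplitQuaternion).imI • h.altγ ImSplit.s ImSplit.t x) +
    (ζ : SplitQuaternion).imJ • h.altγ ImSplit.t ImSplit.i x +
    (ζ : SplitQuaternion).imK • h.altγ ImSplit.i ImSplit.s x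

/-- `ρ(ξ, η) = ι_{K_η} γ₁(ξ)`. -/
def ρ (ξ η : ImSplit) (x : M) : ℝ := h.γ₁ ξ x (fundVF E η x)

/-- `ρ₀ = (1/3) tr ρ`. -/
def ρ₀ (x : M) : ℝ := (1 / 3 : ℝ) * ImSplit.tr (fun ξ η => h.ρ ξ η x)

/-- `ρ₂`, the trace-free symmetric part of `ρ`. -/
def ρ₂ (ξ η : ImSplit) (x : M) : ℝ :=
  (1 / 2 : ℝ) * (h.ρ ξ η x + h.ρ η ξ x) - ImSplit.bform ξ η * h.ρ₀ x

end Hypersymplectic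

end

noncomputable section

/-! ### Exterior derivatives of 1-forms and 2-forms on a vector space -/

section VectorSpace

variable {E : Type*} [NormedAddCommGroup E] [NormedSpace ℝ E]

/-! Differentiating the action gives L_{K_η} ω_ξ = ω_{[ξ,η]} and [K_η, K_ξ] = K_{[ξ,η]}. Since ω_ξ
is closed, Cartan's formula yields dγ(ξ,η) = ½ ω_{[ξ,η]}. Antisymmetrising gives dγ₁(ζ) = ω_ζ
(`d_locγ₁`), so the three forms have equivariant primitives. Equivariance reads L_{K_η} γ₁(ξ) =
γ₁([ξ,η]) = γ(ξ,η) − γ(η,ξ) (`lie_locγ₁`), and a second use of Cartan's formula gives dρ(ξ,η) =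
−γ(ξ,η) − γ(η,ξ) (`hasFDerivAt_locρ`). The trace and the trace-free symmetric part of this identity
are dρ₀ = g(X₀, ·) and dρ₂ = g(X₂, ·).

Hence ρ₂ = 0 forces X₂ = 0, because g is nondegenerate. The converse does not integrate dρ₂ = 0,
which would only make ρ₂ locally constant; it is algebra at a point. The values of X₂ at (i,i),
(s,s), (t,t) give K_ξ = 𝕀_ξ X₀ (`fundVF_eq_str_X₀`), so γ₁(ζ) = ½ g(𝕀_ζ X₀, ·) and ρ(ξ,η) = ½⟨ξ,η⟩
g(X₀, X₀), which is pure trace. The formulas for E and for the norms follow from 𝕀_ξ² = −‖ξ‖². The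
potential property follows from J dρ₀ = −g(X₀, J·) = g(J X₀, ·) = 2γ₁.

The calculus takes place in the preferred chart at x, at its centre, where the chart has identity
derivative. `LocalModel` isolates the identities needed there. They are obtained by extending the
action to a smooth map on an open part of 𝔹 × E and differentiating along one-parameter subgroups.
-/

theorem hasFDerivAt_clm_comp {G H : Type*} [NormedAddCommGroup G] [NormedSpace ℝ G]
    [NormedAddCommGroup H] [NormedSpace ℝ H] (L : G →L[ℝ] H) (b : E → G) {y : E}
    (hb : DifferentiableAt ℝ b y) :
    HasFDerivAt (fun z => L (b z)) (L.comp (fderiv ℝ b y)) y :=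
  L.hasFDerivAt.comp y hb.hasFDerivAt

/-- Linear functionals as alternating 1-forms. -/
def oneFormOf (E : Type*) [NormedAddCommGroup E] [NormedSpace ℝ E] :
    (E →L[ℝ] ℝ) →L[ℝ] E [⋀^Fin 1]→L[ℝ] ℝ :=
  (ContinuousAlternatingMap.ofSubsingletonLIE (𝕜 := ℝ) (E := E) (F := ℝ)
    (0 : Fin 1)).toContinuousLinearEquiv.toContinuousLinearMap

theorem oneFormOf_apply (a : E →L[ℝ] ℝ) (v : Fin 1 → E) : oneFormOf E a v = a (v 0) := rfl

theorem extDeriv_oneForm_apply {α : E → E [⋀^Fin 1]→L[ℝ] ℝ} {a : E → E →L[ℝ] ℝ} {y : E}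
    (ha : DifferentiableAt ℝ a y) (h : ∀ᶠ z in 𝓝 y, ∀ v : Fin 1 → E, α z v = a z (v 0))
    (v : Fin 2 → E) :
    extDeriv α y v = fderiv ℝ a y (v 0) (v 1) - fderiv ℝ a y (v 1) (v 0) := by
  have h1 : α =ᶠ[𝓝 y] fun z => oneFormOf E (a z) := by
    filter_upwards [h] with z hz
    ext v
    rw [hz, oneFormOf_apply]
  have h2 : HasFDerivAt (fun z => oneFormOf E (a z))
      ((oneFormOf E).comp
        (fderiv ℝ a y)) y :=
    (oneFormOf E).hasFDerivAt.comp y ha.hasFDerivAt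
  rw [h1.extDeriv_eq, extDeriv, h2.fderiv, ContinuousAlternatingMap.alternatizeUncurryFin_apply]
  simp [Fin.sum_univ_two, Fin.removeNth, oneFormOf_apply]
  ring

/-- The alternation map from bilinear forms to 2-forms. -/
def altTwo (E : Type*) [NormedAddCommGroup E] [NormedSpace ℝ E] :
    (E →L[ℝ] E →L[ℝ] ℝ) →L[ℝ] E [⋀^Fin 2]→L[ℝ] ℝ :=
  (1 / 2 : ℝ) • (ContinuousAlternatingMap.alternatizeUncurryFinCLM ℝ E ℝ).comp
    (ContinuousLinearMap.compL ℝ E (E →L[ℝ] ℝ) (E [⋀^Fin 1]→L[ℝ] ℝ)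
      (oneFormOf E))

theorem altTwo_apply (b : E →L[ℝ] E →L[ℝ] ℝ) (v : Fin 2 → E) :
    altTwo E b v = (1 / 2 : ℝ) * (b (v 0) (v 1) - b (v 1) (v 0)) := by
  simp [altTwo, ContinuousAlternatingMap.alternatizeUncurryFin_apply, Fin.sum_univ_two,
    Fin.removeNth, oneFormOf_apply]
  ring

-- Near y the form is `altTwo` of `b`, and `altTwo` is a fixed continuous linear map, so only `b`
-- has to be differentiated. The factor 1/2 in `altTwo` makes it the identity on skew forms, and
-- skewness of the derivative merges the six alternated terms into three.
set_option synthInstance.maxHeartbeats 200000 in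
theorem extDeriv_twoForm_apply {β : E → E [⋀^Fin 2]→L[ℝ] ℝ} {b : E → E →L[ℝ] E →L[ℝ] ℝ} {y : E}
    (hb : DifferentiableAt ℝ b y) (h : ∀ᶠ z in 𝓝 y, ∀ v : Fin 2 → E, β z v = b z (v 0) (v 1))
    (v : Fin 3 → E) :
    extDeriv β y v = fderiv ℝ b y (v 0) (v 1) (v 2) - fderiv ℝ b y (v 1) (v 0) (v 2)
      + fderiv ℝ b y (v 2) (v 0) (v 1) := by
  have h0 : ∀ᶠ z in 𝓝 y, ∀ u w, b z u w = - b z w u := by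
    filter_upwards [h] with z hz u w
    have := hz ![u, w]
    have h2 := hz ![w, u]
    simp only [Matrix.cons_val_zero, Matrix.cons_val_one] at this h2
    rw [← this, ← h2]
    have h3 := (β z).map_swap ![w, u] (i := 0) (j := 1) (by simp)
    refine Eq.trans ?_ h3
    change (β z) ![u, w] = (β z) _
    congr 1
    ext i
    fin_cases i <;> simp
  -- Skewness holds on a neighbourhood of y, so it can be differentiated.
  have hskew : ∀ x u w, fderiv ℝ b y x u w = - fderiv ℝ b y x w u := by
    intro x u w
    have e1 := (hb.hasFDerivAt.clm_apply (hasFDerivAt_const u y)).clm_apply (hasFDerivAt_const w y)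
    have e2 := ((hb.hasFDerivAt.clm_apply (hasFDerivAt_const w y)).clm_apply
      (hasFDerivAt_const u y)).fun_neg
    have e3 := e1.congr_of_eventuallyEq (f₁ := fun z => - b z w u) (by
      filter_upwards [h0] with z hz using (hz u w).symm)
    have := congrArg (fun L : E →L[ℝ] ℝ => L x) (e3.unique e2)
    simpa using this
  have h1 : β =ᶠ[𝓝 y] fun z => altTwo E (b z) := by
    filter_upwards [h, h0] with z hz hz0
    ext v
    rw [hz, altTwo_apply, hz0 (v 1)]
    ring
  have h2 : HasFDerivAt (fun z => altTwo E (b z))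
      ((altTwo E).comp (fderiv ℝ b y)) y :=
    hasFDerivAt_clm_comp (altTwo E) b hb
  rw [h1.extDeriv_eq, extDeriv, h2.fderiv, ContinuousAlternatingMap.alternatizeUncurryFin_apply]
  simp [Fin.sum_univ_three, Fin.removeNth, altTwo_apply, Fin.succAbove]
  rw [hskew (v 0) (v 2), hskew (v 1) (v 2), hskew (v 2) (v 1)]
  ring

/-! ### First order expansion of a family of diffeomorphisms -/

variable {P : Type*} [NormedAddCommGroup P] [NormedSpace ℝ P]

/-- The velocity field at parameter `p₀` in direction `η` of a family `F (p, ·)` of maps. -/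
def velocity (F : P × E → E) (p₀ : P) (η : P) (z : E) : E := fderiv ℝ F (p₀, z) (η, 0)

theorem contDiffAt_velocity {F : P × E → E} {p₀ : P} {y₀ : E} (hF : ContDiffAt ℝ ∞ F (p₀, y₀))
    (η : P) : ContDiffAt ℝ ∞ (velocity F p₀ η) y₀ := by
  have h1 : ContDiffAt ℝ ∞ (fderiv ℝ F) (p₀, y₀) := hF.fderiv_right (by simp)
  have h2 : ContDiffAt ℝ ∞ (fun z : E => fderiv ℝ F (p₀, z)) y₀ :=
    h1.comp y₀ (contDiffAt_const.prodMk contDiffAt_id)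
  exact h2.clm_apply contDiffAt_const

theorem hasDerivAt_family {F : P × E → E} {p₀ : P} {y₀ : E} (hF : DifferentiableAt ℝ F (p₀, y₀))
    {q : ℝ → P} {η : P} (hq : HasDerivAt q η 0) (hq0 : q 0 = p₀) :
    HasDerivAt (fun t => F (q t, y₀)) (velocity F p₀ η y₀) 0 := by
  have h1 : HasFDerivAt F (fderiv ℝ F (p₀, y₀)) (q 0, y₀) := by
    rw [hq0]
    exact hF.hasFDerivAt
  exact h1.comp_hasDerivAt (0 : ℝ) (hq.prodMk (hasDerivAt_const _ _))

/-- Equality of mixed partials: the parameter derivative of the space derivative of `F` is the space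
derivative of its velocity field. -/
theorem hasDerivAt_fderiv_family {F : P × E → E} {p₀ : P} {y₀ : E}
    (hF : ContDiffAt ℝ ∞ F (p₀, y₀))
    {q : ℝ → P} {η : P} (hq : HasDerivAt q η 0) (hq0 : q 0 = p₀) :
    HasDerivAt (fun t => (fderiv ℝ F (q t, y₀)).comp (ContinuousLinearMap.inr ℝ P E))
      (fderiv ℝ (velocity F p₀ η) y₀) 0 := by
  have h1 : ContDiffAt ℝ ∞ (fderiv ℝ F) (p₀, y₀) := hF.fderiv_right (by simp)
  have h2 : HasFDerivAt (fderiv ℝ F) (fderiv ℝ (fderiv ℝ F) (p₀, y₀)) (p₀, y₀) :=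
    (h1.differentiableAt (by simp)).hasFDerivAt
  have h2' : HasFDerivAt (fderiv ℝ F) (fderiv ℝ (fderiv ℝ F) (p₀, y₀)) (q 0, y₀) := by rwa [hq0]
  have h3 : HasDerivAt (fun t => fderiv ℝ F (q t, y₀)) (fderiv ℝ (fderiv ℝ F) (p₀, y₀) (η, 0)) 0 :=
    h2'.comp_hasDerivAt (0 : ℝ) (hq.prodMk (hasDerivAt_const _ _))
  have h4 : HasDerivAt (fun t => (fderiv ℝ F (q t, y₀)).comp (ContinuousLinearMap.inr ℝ P E))
      ((fderiv ℝ (fderiv ℝ F) (p₀, y₀) (η, 0)).comp (ContinuousLinearMap.inr ℝ P E)) 0 := by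
    simpa using h3.clm_comp (hasDerivAt_const _ _)
  convert h4 using 1
  have h5 : HasFDerivAt (fun z : E => fderiv ℝ F (p₀, z))
      ((fderiv ℝ (fderiv ℝ F) (p₀, y₀)).comp (ContinuousLinearMap.inr ℝ P E)) y₀ :=
    h2.comp y₀ (hasFDerivAt_prodMk_right p₀ y₀)
  have h6 := h5.clm_apply (hasFDerivAt_const ((η, 0) : P × E) y₀)
  have h7 : fderiv ℝ (velocity F p₀ η) y₀ = _ := h6.fderiv
  rw [h7]
  ext u
  have hsymm : IsSymmSndFDerivAt ℝ F (p₀, y₀) := hF.isSymmSndFDerivAt (by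
    simp only [minSmoothness_of_isRCLikeNormedField]
    exact WithTop.coe_le_coe.2 le_top)
  simpa using hsymm.eq (0, u) (η, 0)

theorem fderiv_family_inr {F : P × E → E} {p₀ : P} {y₀ : E} (hF : ContDiffAt ℝ ∞ F (p₀, y₀))
    (hid : ∀ᶠ z in 𝓝 y₀, F (p₀, z) = z) :
    (fderiv ℝ F (p₀, y₀)).comp (ContinuousLinearMap.inr ℝ P E) = ContinuousLinearMap.id ℝ E := by
  have h1 : HasFDerivAt F (fderiv ℝ F (p₀, y₀)) (p₀, y₀) :=
    (hF.differentiableAt (by simp)).hasFDerivAt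
  have h2 := h1.comp y₀ (hasFDerivAt_prodMk_right p₀ y₀)
  exact h2.unique ((hasFDerivAt_id y₀).congr_of_eventuallyEq hid)

end VectorSpace

/-! ### Brackets and the inner product of Im 𝔹 in coordinates -/

namespace ImSplit

theorem re_eq_zero (ξ : ImSplit) : (ξ : SplitQuaternion).re = 0 := by
  have h := congrArg QuaternionAlgebra.re (skewAdjoint.mem_iff.1 ξ.2)
  rw [QuaternionAlgebra.re_star, QuaternionAlgebra.re_neg] at h
  linarith

/-- The commutator of two imaginary split quaternions. -/
def lie (ξ η : ImSplit) : ImSplit :=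
  ⟨(ξ : SplitQuaternion) * η - η * ξ, by
    rw [skewAdjoint.mem_iff, star_sub, star_mul, star_mul, skewAdjoint.mem_iff.1 ξ.2,
      skewAdjoint.mem_iff.1 η.2]
    noncomm_ring⟩

theorem lie_imI (ξ η : ImSplit) : (lie ξ η : SplitQuaternion).imI =
    2 * ((ξ : SplitQuaternion).imK * (η : SplitQuaternion).imJ -
      (ξ : SplitQuaternion).imJ * (η : SplitQuaternion).imK) := by
  simp [lie, re_eq_zero]
  ring

theorem lie_imJ (ξ η : ImSplit) : (lie ξ η : SplitQuaternion).imJ =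
    2 * ((ξ : SplitQuaternion).imK * (η : SplitQuaternion).imI -
      (ξ : SplitQuaternion).imI * (η : SplitQuaternion).imK) := by
  simp [lie, re_eq_zero]
  ring

theorem lie_imK (ξ η : ImSplit) : (lie ξ η : SplitQuaternion).imK =
    2 * ((ξ : SplitQuaternion).imI * (η : SplitQuaternion).imJ -
      (ξ : SplitQuaternion).imJ * (η : SplitQuaternion).imI) := by
  simp [lie, re_eq_zero]
  ring

theorem bform_eq (ξ η : ImSplit) : bform ξ η =
    (ξ : SplitQuaternion).imI * (η : SplitQuaternion).imI -
      (ξ : SplitQuaternion).imJ * (η : SplitQuaternion).imJ -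
      (ξ : SplitQuaternion).imK * (η : SplitQuaternion).imK := by
  simp [bform, SplitQuaternion.bform, re_eq_zero]
  ring

theorem nsq_eq (ξ : ImSplit) : nsq ξ = bform ξ ξ := rfl

end ImSplit

/-! ### Cartan calculus for γ, γ₁ and ρ at one point of a vector space -/

section VectorSpace

variable {E : Type*} [NormedAddCommGroup E] [NormedSpace ℝ E]

/-- Product rule. With `c` a flow line and `L` the differential of the flow, the value is the
coordinate expression of the Lie derivative of `b`. -/
theorem hasDerivAt_pullback_form {b : E → E →L[ℝ] E →L[ℝ] ℝ} {y : E}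
    (hb : DifferentiableAt ℝ b y) {c : ℝ → E} {c' : E} (hc : HasDerivAt c c' 0) (hc0 : c 0 = y)
    {L : ℝ → E →L[ℝ] E} {L' : E →L[ℝ] E} (hL : HasDerivAt L L' 0)
    (hL0 : L 0 = ContinuousLinearMap.id ℝ E) (u v : E) :
    HasDerivAt (fun t => b (c t) (L t u) (L t v))
      (fderiv ℝ b y c' u v + b y (L' u) v + b y u (L' v)) 0 := by
  subst hc0
  have h1 : HasDerivAt (fun t => b (c t)) (fderiv ℝ b (c 0) c') 0 :=
    HasFDerivAt.comp_hasDerivAt (l := b) (f := c) (0 : ℝ) hb.hasFDerivAt hc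
  have h2 := (h1.clm_apply (hL.clm_apply (hasDerivAt_const 0 u))).clm_apply
    (hL.clm_apply (hasDerivAt_const 0 v))
  simpa [hL0] using h2

/-- The 1-form `b (k, ·)`. -/
theorem hasFDerivAt_contract {b : E → E →L[ℝ] E →L[ℝ] ℝ} {k : E → E} {y : E}
    (hb : DifferentiableAt ℝ b y) (hk : DifferentiableAt ℝ k y) :
    HasFDerivAt (fun z => b z (k z))
      ((b y).comp (fderiv ℝ k y) + (fderiv ℝ b y).flip (k y)) y :=
  hb.hasFDerivAt.clm_apply hk.hasFDerivAt

/-- Closed forms `w ξ` and vector fields `k ξ`, indexed by `Im 𝔹`, which at the point `y` satisfy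
the infinitesimal equivariance relations of a permuting action. -/
structure LocalModel (w : ImSplit → E → E →L[ℝ] E →L[ℝ] ℝ) (k : ImSplit → E → E) (y : E) :
    Prop where
  diff_w : ∀ ξ, DifferentiableAt ℝ (w ξ) y
  diff_k : ∀ ξ, DifferentiableAt ℝ (k ξ) y
  skew : ∀ ξ u v, w ξ y u v = -w ξ y v u
  w_lin : ∀ ξ u v, w ξ y u v = (ξ : SplitQuaternion).imI * w ImSplit.i y u v +
    (ξ : SplitQuaternion).imJ * w ImSplit.s y u v + (ξ : SplitQuaternion).imK * w ImSplit.t y u v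
  k_lin : ∀ ξ, k ξ y = (ξ : SplitQuaternion).imI • k ImSplit.i y +
    (ξ : SplitQuaternion).imJ • k ImSplit.s y + (ξ : SplitQuaternion).imK • k ImSplit.t y
  closed : ∀ ξ u v x, fderiv ℝ (w ξ) y u v x - fderiv ℝ (w ξ) y v u x + fderiv ℝ (w ξ) y x u v = 0
  lie_w : ∀ ξ η u v, fderiv ℝ (w ξ) y (k η y) u v + w ξ y (fderiv ℝ (k η) y u) v +
    w ξ y u (fderiv ℝ (k η) y v) = w (ImSplit.lie ξ η) y u v
  lie_k : ∀ ξ η, fderiv ℝ (k ξ) y (k η y) - fderiv ℝ (k η) y (k ξ y) = k (ImSplit.lie ξ η) y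

/-- Local version of `Hypersymplectic.γ`. -/
def locγ (w : ImSplit → E → E →L[ℝ] E →L[ℝ] ℝ) (k : ImSplit → E → E) (ξ η : ImSplit) (z : E) :
    E →L[ℝ] ℝ := (1 / 2 : ℝ) • w ξ z (k η z)

/-- Local version of `Hypersymplectic.altγ`. -/
def locAltγ (w : ImSplit → E → E →L[ℝ] E →L[ℝ] ℝ) (k : ImSplit → E → E) (ξ η : ImSplit) (z : E) :
    E →L[ℝ] ℝ := (1 / 2 : ℝ) • (locγ w k ξ η z - locγ w k η ξ z)

/-- Local version of `Hypersymplectic.γ₁`. -/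
def locγ₁ (w : ImSplit → E → E →L[ℝ] E →L[ℝ] ℝ) (k : ImSplit → E → E) (ζ : ImSplit) (z : E) :
    E →L[ℝ] ℝ :=
  -((ζ : SplitQuaternion).imI • locAltγ w k ImSplit.s ImSplit.t z) +
    (ζ : SplitQuaternion).imJ • locAltγ w k ImSplit.t ImSplit.i z +
    (ζ : SplitQuaternion).imK • locAltγ w k ImSplit.i ImSplit.s z

namespace LocalModel

variable {w : ImSplit → E → E →L[ℝ] E →L[ℝ] ℝ} {k : ImSplit → E → E} {y : E}

theorem locγ_hasFDerivAt (H : LocalModel w k y) (ξ η : ImSplit) :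
    HasFDerivAt (locγ w k ξ η)
      ((1 / 2 : ℝ) • ((w ξ y).comp (fderiv ℝ (k η) y) + (fderiv ℝ (w ξ) y).flip (k η y))) y :=
  (hasFDerivAt_contract (H.diff_w ξ) (H.diff_k η)).const_smul (1 / 2 : ℝ)

theorem differentiableAt_locγ (H : LocalModel w k y) (ξ η : ImSplit) :
    DifferentiableAt ℝ (locγ w k ξ η) y := (H.locγ_hasFDerivAt ξ η).differentiableAt

set_option synthInstance.maxHeartbeats 200000 in
theorem fderiv_locγ_apply (H : LocalModel w k y) (ξ η : ImSplit) (u v : E) :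
    fderiv ℝ (locγ w k ξ η) y u v =
      1 / 2 * (w ξ y (fderiv ℝ (k η) y u) v + fderiv ℝ (w ξ) y u (k η y) v) := by
  rw [(H.locγ_hasFDerivAt ξ η).fderiv]
  simp
  ring

theorem hasFDerivAt_locAltγ (H : LocalModel w k y) (ξ η : ImSplit) :
    HasFDerivAt (locAltγ w k ξ η)
      ((1 / 2 : ℝ) • (fderiv ℝ (locγ w k ξ η) y - fderiv ℝ (locγ w k η ξ) y)) y :=
  ((H.differentiableAt_locγ ξ η).hasFDerivAt.fun_sub
    (H.differentiableAt_locγ η ξ).hasFDerivAt).const_smul (1 / 2 : ℝ)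

theorem hasFDerivAt_locγ₁ (H : LocalModel w k y) (ζ : ImSplit) :
    HasFDerivAt (locγ₁ w k ζ)
      (-((ζ : SplitQuaternion).imI • fderiv ℝ (locAltγ w k ImSplit.s ImSplit.t) y) +
        (ζ : SplitQuaternion).imJ • fderiv ℝ (locAltγ w k ImSplit.t ImSplit.i) y +
        (ζ : SplitQuaternion).imK • fderiv ℝ (locAltγ w k ImSplit.i ImSplit.s) y) y := by
  have h1 := ((H.hasFDerivAt_locAltγ ImSplit.s ImSplit.t).differentiableAt.hasFDerivAt).const_smul
    (ζ : SplitQuaternion).imI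
  have h2 := ((H.hasFDerivAt_locAltγ ImSplit.t ImSplit.i).differentiableAt.hasFDerivAt).const_smul
    (ζ : SplitQuaternion).imJ
  have h3 := ((H.hasFDerivAt_locAltγ ImSplit.i ImSplit.s).differentiableAt.hasFDerivAt).const_smul
    (ζ : SplitQuaternion).imK
  exact (h1.neg.add h2).add h3

set_option synthInstance.maxHeartbeats 200000 in
theorem fderiv_locγ₁_apply (H : LocalModel w k y) (ζ : ImSplit) (u v : E) :
    fderiv ℝ (locγ₁ w k ζ) y u v =
      -((ζ : SplitQuaternion).imI * (1 / 2 * (fderiv ℝ (locγ w k ImSplit.s ImSplit.t) y u v -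
          fderiv ℝ (locγ w k ImSplit.t ImSplit.s) y u v))) +
        (ζ : SplitQuaternion).imJ * (1 / 2 * (fderiv ℝ (locγ w k ImSplit.t ImSplit.i) y u v -
          fderiv ℝ (locγ w k ImSplit.i ImSplit.t) y u v)) +
        (ζ : SplitQuaternion).imK * (1 / 2 * (fderiv ℝ (locγ w k ImSplit.i ImSplit.s) y u v -
          fderiv ℝ (locγ w k ImSplit.s ImSplit.i) y u v)) := by
  rw [(H.hasFDerivAt_locγ₁ ζ).fderiv, (H.hasFDerivAt_locAltγ _ _).fderiv,
    (H.hasFDerivAt_locAltγ _ _).fderiv, (H.hasFDerivAt_locAltγ _ _).fderiv]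
  simp

/-- Cartan's formula: `d γ(ξ, η) = (1/2) ω_[ξ, η]`. -/
theorem d_locγ (H : LocalModel w k y) (ξ η : ImSplit) (u v : E) :
    fderiv ℝ (locγ w k ξ η) y u v - fderiv ℝ (locγ w k ξ η) y v u =
      1 / 2 * w (ImSplit.lie ξ η) y u v := by
  rw [H.fderiv_locγ_apply, H.fderiv_locγ_apply, ← H.lie_w]
  have h1 := H.closed ξ (k η y) u v
  have h2 := H.skew ξ u (fderiv ℝ (k η) y v)
  linarith

/-- The antisymmetric part of γ has differential ½ ω_{[ξ,η]} by `d_locγ`. Since γ₁ reads that part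
through ½[ξ,η], the bracket and the factor cancel. The check is on the pairs (s,t), (t,i), (i,s). -/
theorem d_locγ₁ (H : LocalModel w k y) (ζ : ImSplit) (u v : E) :
    fderiv ℝ (locγ₁ w k ζ) y u v - fderiv ℝ (locγ₁ w k ζ) y v u = w ζ y u v := by
  rw [H.fderiv_locγ₁_apply, H.fderiv_locγ₁_apply]
  have h1 := H.d_locγ ImSplit.s ImSplit.t u v
  have h2 := H.d_locγ ImSplit.t ImSplit.s u v
  have h3 := H.d_locγ ImSplit.t ImSplit.i u v
  have h4 := H.d_locγ ImSplit.i ImSplit.t u v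
  have h5 := H.d_locγ ImSplit.i ImSplit.s u v
  have h6 := H.d_locγ ImSplit.s ImSplit.i u v
  rw [H.w_lin, ImSplit.lie_imI, ImSplit.lie_imJ, ImSplit.lie_imK] at h1 h2 h3 h4 h5 h6
  rw [H.w_lin]
  simp [ImSplit.i, ImSplit.s, ImSplit.t] at h1 h2 h3 h4 h5 h6 ⊢
  linear_combination (-(ζ : SplitQuaternion).imI / 2) * (h1 - h2) +
    ((ζ : SplitQuaternion).imJ / 2) * (h3 - h4) + ((ζ : SplitQuaternion).imK / 2) * (h5 - h6)

/-- Infinitesimal equivariance of `γ`. -/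
theorem lie_locγ (H : LocalModel w k y) (ξ ζ η : ImSplit) (v : E) :
    fderiv ℝ (locγ w k ξ ζ) y (k η y) v + locγ w k ξ ζ y (fderiv ℝ (k η) y v) =
      locγ w k (ImSplit.lie ξ η) ζ y v + locγ w k ξ (ImSplit.lie ζ η) y v := by
  rw [H.fderiv_locγ_apply]
  simp only [locγ, smul_apply, smul_eq_mul]
  -- Leibniz rule for the contraction of ω_ξ with K_ζ: put K_ζ in the first slot of the Lie
  -- derivative of ω_ξ, then use `lie_k` to trade the derivative of K_η along K_ζ for that of K_ζ
  -- along K_η.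
  have h1 := H.lie_w ξ η (k ζ y) v
  have h2 := congrArg (fun x => w ξ y x v) (H.lie_k ζ η)
  simp only [map_sub, sub_apply] at h2
  linarith

theorem locγ_lin (H : LocalModel w k y) (ξ η : ImSplit) (v : E) :
    locγ w k ξ η y v =
      (ξ : SplitQuaternion).imI * ((η : SplitQuaternion).imI * locγ w k ImSplit.i ImSplit.i y v +
        (η : SplitQuaternion).imJ * locγ w k ImSplit.i ImSplit.s y v +
        (η : SplitQuaternion).imK * locγ w k ImSplit.i ImSplit.t y v) +
      (ξ : SplitQuaternion).imJ * ((η : SplitQuaternion).imI * locγ w k ImSplit.s ImSplit.i y v +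
        (η : SplitQuaternion).imJ * locγ w k ImSplit.s ImSplit.s y v +
        (η : SplitQuaternion).imK * locγ w k ImSplit.s ImSplit.t y v) +
      (ξ : SplitQuaternion).imK * ((η : SplitQuaternion).imI * locγ w k ImSplit.t ImSplit.i y v +
        (η : SplitQuaternion).imJ * locγ w k ImSplit.t ImSplit.s y v +
        (η : SplitQuaternion).imK * locγ w k ImSplit.t ImSplit.t y v) := by
  simp only [locγ, smul_apply, smul_eq_mul]
  rw [H.w_lin ξ, H.k_lin η]
  simp only [map_add, map_smul, add_apply, smul_apply, smul_eq_mul]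
  ring

/-- Infinitesimal equivariance of `γ₁`. -/
theorem lie_locγ₁ (H : LocalModel w k y) (ξ η : ImSplit) (v : E) :
    fderiv ℝ (locγ₁ w k ξ) y (k η y) v + locγ₁ w k ξ y (fderiv ℝ (k η) y v) =
      locγ w k ξ η y v - locγ w k η ξ y v := by
  rw [H.fderiv_locγ₁_apply]
  simp only [locγ₁, locAltγ, add_apply, neg_apply, smul_apply, sub_apply, smul_eq_mul]
  have h1 := H.lie_locγ ImSplit.s ImSplit.t η v
  have h2 := H.lie_locγ ImSplit.t ImSplit.s η v
  have h3 := H.lie_locγ ImSplit.t ImSplit.i η v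
  have h4 := H.lie_locγ ImSplit.i ImSplit.t η v
  have h5 := H.lie_locγ ImSplit.i ImSplit.s η v
  have h6 := H.lie_locγ ImSplit.s ImSplit.i η v
  -- The right-hand side is γ₁([ξ,η]) by the defining relation of γ₁. Expanding every γ in its nine
  -- components on the basis i, s, t reduces equivariance to a linear identity.
  rw [H.locγ_lin (ImSplit.lie _ _), H.locγ_lin _ (ImSplit.lie _ _)] at h1 h2 h3 h4 h5 h6
  rw [H.locγ_lin ξ η, H.locγ_lin η ξ]
  simp only [ImSplit.lie_imI, ImSplit.lie_imJ, ImSplit.lie_imK] at h1 h2 h3 h4 h5 h6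
  have e1 : (ImSplit.i : SplitQuaternion).imI = 1 := rfl
  have e2 : (ImSplit.i : SplitQuaternion).imJ = 0 := rfl
  have e3 : (ImSplit.i : SplitQuaternion).imK = 0 := rfl
  have e4 : (ImSplit.s : SplitQuaternion).imI = 0 := rfl
  have e5 : (ImSplit.s : SplitQuaternion).imJ = 1 := rfl
  have e6 : (ImSplit.s : SplitQuaternion).imK = 0 := rfl
  have e7 : (ImSplit.t : SplitQuaternion).imI = 0 := rfl
  have e8 : (ImSplit.t : SplitQuaternion).imJ = 0 := rfl
  have e9 : (ImSplit.t : SplitQuaternion).imK = 1 := rfl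
  simp only [e1, e2, e3, e4, e5, e6, e7, e8, e9] at h1 h2 h3 h4 h5 h6
  linear_combination (-(ξ : SplitQuaternion).imI / 2) * (h1 - h2) +
    ((ξ : SplitQuaternion).imJ / 2) * (h3 - h4) + ((ξ : SplitQuaternion).imK / 2) * (h5 - h6)

/-- Cartan's formula for the contraction of γ₁(ξ) with K_η: the Lie derivative contributes γ(ξ,η) −
γ(η,ξ), while contracting dγ₁(ξ) = ω_ξ with K_η removes 2γ(ξ,η). -/
theorem hasFDerivAt_locρ (H : LocalModel w k y) (ξ η : ImSplit) :
    HasFDerivAt (fun z => locγ₁ w k ξ z (k η z)) (-locγ w k ξ η y - locγ w k η ξ y) y := by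
  have h1 := (H.hasFDerivAt_locγ₁ ξ).differentiableAt.hasFDerivAt.clm_apply
    (H.diff_k η).hasFDerivAt
  refine h1.congr_fderiv ?_
  ext v
  have h2 := H.lie_locγ₁ ξ η v
  have h3 := H.d_locγ₁ ξ v (k η y)
  have h4 := H.skew ξ v (k η y)
  have h5 : w ξ y (k η y) v = 2 * locγ w k ξ η y v := by simp [locγ]
  simp only [add_apply, neg_apply, sub_apply, ContinuousLinearMap.comp_apply,
    ContinuousLinearMap.flip_apply]
  linarith

end LocalModel

end VectorSpace

/-! ### The preferred chart, its derivatives, and exterior derivatives read in it -/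

section Charts

variable {E : Type*} [NormedAddCommGroup E] [NormedSpace ℝ E]
  {M : Type*} [TopologicalSpace M] [ChartedSpace E M]

/-- The derivative of the inverse of the preferred chart at `x`. -/
def chartInvDeriv (x : M) (z : E) : E →L[ℝ] E :=
  mfderiv 𝓘(ℝ, E) 𝓘(ℝ, E) (extChartAt 𝓘(ℝ, E) x).symm z

/-- The derivative at `p` of the preferred chart at `x`. -/
def chartDeriv (x p : M) : E →L[ℝ] E :=
  mfderiv 𝓘(ℝ, E) 𝓘(ℝ, E) (extChartAt 𝓘(ℝ, E) x) p

variable [IsManifold 𝓘(ℝ, E) ∞ M]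

theorem chartDeriv_chartInvDeriv {x : M} {z : E} (hz : z ∈ (extChartAt 𝓘(ℝ, E) x).target) (u : E) :
    chartDeriv x ((extChartAt 𝓘(ℝ, E) x).symm z) (chartInvDeriv x z u) = u := by
  have h := mfderiv_extChartAt_comp_mfderivWithin_extChartAt_symm (I := 𝓘(ℝ, E)) hz
  rw [modelWithCornersSelf_coe, Set.range_id, mfderivWithin_univ] at h
  exact congrArg (fun L : E →L[ℝ] E => L u) h

theorem chartDeriv_self (x : M) : chartDeriv x x = ContinuousLinearMap.id ℝ E :=
  mfderiv_extChartAt_self (I := 𝓘(ℝ, E)) (x := x)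

theorem chartInvDeriv_self (x : M) :
    chartInvDeriv x (extChartAt 𝓘(ℝ, E) x x) = ContinuousLinearMap.id ℝ E := by
  have h := mfderivWithin_range_extChartAt_symm (I := 𝓘(ℝ, E)) (x := x)
  rwa [modelWithCornersSelf_coe, Set.range_id, mfderivWithin_univ] at h

theorem chartInvDeriv_injective {x : M} {z : E} (hz : z ∈ (extChartAt 𝓘(ℝ, E) x).target) :
    Function.Injective (chartInvDeriv x z) :=
  Function.LeftInverse.injective (chartDeriv_chartInvDeriv hz)

theorem hasMFDerivAt_extChartAt_symm {x : M} {z : E} (hz : z ∈ (extChartAt 𝓘(ℝ, E) x).target) :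
    HasMFDerivAt 𝓘(ℝ, E) 𝓘(ℝ, E) (extChartAt 𝓘(ℝ, E) x).symm z
      (show TangentSpace 𝓘(ℝ, E) z →L[ℝ] TangentSpace 𝓘(ℝ, E) ((extChartAt 𝓘(ℝ, E) x).symm z) from
        chartInvDeriv (E := E) x z) := by
  have h := mdifferentiableWithinAt_extChartAt_symm (I := 𝓘(ℝ, E)) hz
  rw [modelWithCornersSelf_coe, Set.range_id, mdifferentiableWithinAt_univ] at h
  exact h.hasMFDerivAt

theorem hasMFDerivAt_extChartAt' {x p : M} (hp : p ∈ (extChartAt 𝓘(ℝ, E) x).source) :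
    HasMFDerivAt 𝓘(ℝ, E) 𝓘(ℝ, E) (extChartAt 𝓘(ℝ, E) x) p
      (show TangentSpace 𝓘(ℝ, E) p →L[ℝ] TangentSpace 𝓘(ℝ, E) (extChartAt 𝓘(ℝ, E) x p) from
        chartDeriv (E := E) x p) := by
  rw [extChartAt_source] at hp
  exact (mdifferentiableAt_extChartAt (I := 𝓘(ℝ, E)) hp).hasMFDerivAt

theorem contMDiffAt_extChartAt_symm (x : M) :
    ContMDiffAt 𝓘(ℝ, E) 𝓘(ℝ, E) ∞ (extChartAt 𝓘(ℝ, E) x).symm (extChartAt 𝓘(ℝ, E) x x) :=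
  (contMDiffOn_extChartAt_symm x).contMDiffAt (extChartAt_target_mem_nhds x)

/-- The exterior derivative at `x` of a form with components `α'` in the chart at `x`. -/
theorem mExtDeriv_apply {p : ℕ} (α : ∀ x : M, TangentSpace 𝓘(ℝ, E) x [⋀^Fin p]→L[ℝ] ℝ) (x : M)
    (v : Fin (p + 1) → E) :
    mExtDeriv α x v = extDeriv (E := E) (fun y : E =>
      ContinuousAlternatingMap.compContinuousLinearMap
        (show E [⋀^Fin p]→L[ℝ] ℝ from α ((extChartAt 𝓘(ℝ, E) x).symm y))
        (chartInvDeriv x y)) (extChartAt 𝓘(ℝ, E) x x) v := by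
  -- At the centre the chart has identity derivative, so the outer pullback in `mExtDeriv`
  -- disappears.
  have h : ∀ u : E, chartDeriv x x u = u := fun u => by rw [chartDeriv_self]; rfl
  change (extDeriv (E := E) (fun y : E =>
      ContinuousAlternatingMap.compContinuousLinearMap
        (show E [⋀^Fin p]→L[ℝ] ℝ from α ((extChartAt 𝓘(ℝ, E) x).symm y))
        (chartInvDeriv x y)) (extChartAt 𝓘(ℝ, E) x x)) (fun i => chartDeriv x x (v i)) = _
  simp only [h]

theorem mExtDeriv_smul {p : ℕ} (c : ℝ)
    (α : ∀ x : M, TangentSpace 𝓘(ℝ, E) x [⋀^Fin p]→L[ℝ] ℝ) (x : M) :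
    mExtDeriv (fun y => c • α y) x = c • mExtDeriv α x := by
  refine ContinuousAlternatingMap.ext fun v => ?_
  refine (mExtDeriv_apply (E := E) (fun y => c • α y) x v).trans ?_
  refine Eq.trans ?_ (congrArg (fun r => c * r) (mExtDeriv_apply (E := E) α x v)).symm
  exact congrArg (fun L : E [⋀^Fin (p + 1)]→L[ℝ] ℝ => L v)
    (extDeriv_smul c (fun y : E => ContinuousAlternatingMap.compContinuousLinearMap
        (show E [⋀^Fin p]→L[ℝ] ℝ from α ((extChartAt 𝓘(ℝ, E) x).symm y)) (chartInvDeriv x y)))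

/-- A tangent vector at the centre of a chart extends to a constant, hence smooth, local field. -/
theorem contMDiffAt_chartFrame (x : M) (u : E) :
    ContMDiffAt 𝓘(ℝ, E) (𝓘(ℝ, E).prod 𝓘(ℝ, E)) ∞
      (fun p : M => TotalSpace.mk' E (E := fun p : M => TangentSpace 𝓘(ℝ, E) p) p
        (chartInvDeriv x (extChartAt 𝓘(ℝ, E) x p) u)) x := by
  have h1 := (trivializationAt E (TangentSpace 𝓘(ℝ, E)) x).contMDiffAt_symmL
    (IB := 𝓘(ℝ, E)) (n := ∞) (mem_baseSet_trivializationAt E (TangentSpace 𝓘(ℝ, E)) x)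
  have h2 : ContMDiffAt 𝓘(ℝ, E) (𝓘(ℝ, E).prod 𝓘(ℝ, E)) ∞
      (fun p : M => TotalSpace.mk' E (E := Bundle.Trivial M E) p u) x :=
    contMDiffAt_totalSpace.2 ⟨contMDiffAt_id, contMDiffAt_const⟩
  refine (h1.clm_bundle_apply h2).congr_of_eventuallyEq ?_
  filter_upwards [(chartAt E x).open_source.mem_nhds (mem_chart_source E x)] with p hp
  have h := TangentBundle.symmL_trivializationAt (I := 𝓘(ℝ, E)) hp
  rw [modelWithCornersSelf_coe, Set.range_id, mfderivWithin_univ] at h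
  rw [h]
  rfl

end Charts

/-- After identifying E with ℝ^d, an operator on E is the d-tuple of its values on a basis, so
smoothness may be tested on vectors. This is where finite dimension of E enters. -/
theorem contDiffAt_clm_of_apply {E F G : Type*} [NormedAddCommGroup E] [NormedSpace ℝ E]
    [FiniteDimensional ℝ E]
    [NormedAddCommGroup F] [NormedSpace ℝ F] [NormedAddCommGroup G] [NormedSpace ℝ G]
    {f : G → E →L[ℝ] F} {y : G}
    (h : ∀ u, ContDiffAt ℝ ∞ (fun z => f z u) y) : ContDiffAt ℝ ∞ f y := by
  let d := Module.finrank ℝ E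
  have hd : d = Module.finrank ℝ (Fin d → ℝ) := (Module.finrank_fin_fun ℝ).symm
  let e₁ := ContinuousLinearEquiv.ofFinrankEq hd
  let e₂ := (e₁.arrowCongr (1 : F ≃L[ℝ] F)).trans (ContinuousLinearEquiv.piRing (Fin d))
  rw [← Function.id_comp f, ← e₂.symm_comp_self]
  exact e₂.symm.contDiff.contDiffAt.comp y (contDiffAt_pi.mpr fun i => h _)

/-! ### Chart components of ω_ξ: smoothness, linearity in ξ and closedness -/

namespace AlmostHypersymplectic

variable {n : ℕ} {E : Type*} [NormedAddCommGroup E] [NormedSpace ℝ E]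
  {M : Type*} [TopologicalSpace M] [ChartedSpace E M] [IsManifold 𝓘(ℝ, E) ∞ M]
  (h : AlmostHypersymplectic n E M)

/-- The vectors are fed in through the coordinate frame of the chart at x, so these are the local
components of the tensor g(J·, ·). -/
theorem contMDiffAt_g_apply
    {J : ∀ x : M, TangentSpace 𝓘(ℝ, E) x →L[ℝ] TangentSpace 𝓘(ℝ, E) x}
    (hJ : ContMDiff 𝓘(ℝ, E) (𝓘(ℝ, E).prod 𝓘(ℝ, E →L[ℝ] E)) ∞
    (fun x => TotalSpace.mk' (E →L[ℝ] E)
      (E := fun x : M => TangentSpace 𝓘(ℝ, E) x →L[ℝ] TangentSpace 𝓘(ℝ, E) x) x (J x)))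
    (x : M) (u v : E) :
    ContMDiffAt 𝓘(ℝ, E) 𝓘(ℝ, ℝ) ∞ (fun p : M => h.g p
      (J p (chartInvDeriv x (extChartAt 𝓘(ℝ, E) x p) u))
      (chartInvDeriv x (extChartAt 𝓘(ℝ, E) x p) v)) x := by
  have h1 := (hJ x).clm_bundle_apply (contMDiffAt_chartFrame x u)
  have h2 := ContMDiffAt.clm_bundle_apply₂ (E₃ := Bundle.Trivial M ℝ) (h.smooth_g x) h1 (contMDiffAt_chartFrame x v)
  exact (contMDiffAt_totalSpace.1 h2).2

end AlmostHypersymplectic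

section LinearCombination

variable {E G : Type*} [NormedAddCommGroup E] [NormedSpace ℝ E]
  [NormedAddCommGroup G] [NormedSpace ℝ G]

theorem contDiffAt_linearCombination {f₁ f₂ f₃ : E → G} {y : E} (a b c : ℝ)
    (h₁ : ContDiffAt ℝ ∞ f₁ y) (h₂ : ContDiffAt ℝ ∞ f₂ y) (h₃ : ContDiffAt ℝ ∞ f₃ y) :
    ContDiffAt ℝ ∞ (fun z => a • f₁ z + b • f₂ z + c • f₃ z) y :=
  ((contDiffAt_const.smul h₁).add (contDiffAt_const.smul h₂)).add (contDiffAt_const.smul h₃)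

theorem fderiv_linearCombination {f₁ f₂ f₃ : E → G} {y : E} (a b c : ℝ)
    (h₁ : DifferentiableAt ℝ f₁ y) (h₂ : DifferentiableAt ℝ f₂ y) (h₃ : DifferentiableAt ℝ f₃ y)
    (u : E) :
    fderiv ℝ (fun z => a • f₁ z + b • f₂ z + c • f₃ z) y u =
      a • fderiv ℝ f₁ y u + b • fderiv ℝ f₂ y u + c • fderiv ℝ f₃ y u := by
  have h := ((h₁.hasFDerivAt.const_smul a).add (h₂.hasFDerivAt.const_smul b)).add
    (h₃.hasFDerivAt.const_smul c)
  exact congrArg (fun L : E →L[ℝ] G => L u) h.fderiv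

end LinearCombination

namespace AlmostHypersymplectic

variable {n : ℕ} {E : Type*} [NormedAddCommGroup E] [NormedSpace ℝ E]
  {M : Type*} [TopologicalSpace M] [ChartedSpace E M] [IsManifold 𝓘(ℝ, E) ∞ M]
  (h : AlmostHypersymplectic n E M)

theorem str_apply (ξ : ImSplit) (x : M) (u : TangentSpace 𝓘(ℝ, E) x) :
    h.str ξ x u = (ξ : SplitQuaternion).imI • h.I x u + (ξ : SplitQuaternion).imJ • h.S x u +
      (ξ : SplitQuaternion).imK • h.T x u := rfl

theorem str_i (x : M) (u : TangentSpace 𝓘(ℝ, E) x) : h.str ImSplit.i x u = h.I x u := by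
  simp [str_apply, ImSplit.i]

theorem str_s (x : M) (u : TangentSpace 𝓘(ℝ, E) x) : h.str ImSplit.s x u = h.S x u := by
  simp [str_apply, ImSplit.s]

theorem str_t (x : M) (u : TangentSpace 𝓘(ℝ, E) x) : h.str ImSplit.t x u = h.T x u := by
  simp [str_apply, ImSplit.t]

theorem g_str_skew (ξ : ImSplit) (x : M) (u v : TangentSpace 𝓘(ℝ, E) x) :
    h.g x (h.str ξ x u) v = -h.g x (h.str ξ x v) u := by
  have h1 := h.g_str_self ξ x (u + v)
  simp only [map_add, add_apply, h.g_str_self] at h1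
  linarith

theorem g_str_lin (ξ : ImSplit) (x : M) (u v : TangentSpace 𝓘(ℝ, E) x) :
    h.g x (h.str ξ x u) v = (ξ : SplitQuaternion).imI * h.g x (h.str ImSplit.i x u) v +
      (ξ : SplitQuaternion).imJ * h.g x (h.str ImSplit.s x u) v +
      (ξ : SplitQuaternion).imK * h.g x (h.str ImSplit.t x u) v := by
  rw [h.str_i, h.str_s, h.str_t, h.str_apply ξ]
  simp only [map_add, map_smul, add_apply, smul_apply, smul_eq_mul]

/-- The components of the 2-form `ω_ξ` in the chart at `x`. -/
def locForm (x : M) (ξ : ImSplit) (z : E) : E →L[ℝ] E →L[ℝ] ℝ :=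
  (show E →L[ℝ] E →L[ℝ] ℝ from
    (h.g ((extChartAt 𝓘(ℝ, E) x).symm z)).comp
      (h.str ξ ((extChartAt 𝓘(ℝ, E) x).symm z))).bilinearComp
    (chartInvDeriv x z) (chartInvDeriv x z)

theorem locForm_apply (x : M) (ξ : ImSplit) (z : E) (u v : E) :
    h.locForm x ξ z u v = h.g ((extChartAt 𝓘(ℝ, E) x).symm z)
      (h.str ξ ((extChartAt 𝓘(ℝ, E) x).symm z) (chartInvDeriv x z u)) (chartInvDeriv x z v) := rfl

theorem locForm_skew (x : M) (ξ : ImSplit) (z : E) (u v : E) :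
    h.locForm x ξ z u v = -h.locForm x ξ z v u := by
  rw [locForm_apply, locForm_apply]
  exact h.g_str_skew _ _ _ _

theorem locForm_lin_apply (x : M) (ξ : ImSplit) (z u v : E) :
    h.locForm x ξ z u v = (ξ : SplitQuaternion).imI * h.locForm x ImSplit.i z u v +
      (ξ : SplitQuaternion).imJ * h.locForm x ImSplit.s z u v +
      (ξ : SplitQuaternion).imK * h.locForm x ImSplit.t z u v := by
  simp only [locForm_apply]
  exact h.g_str_lin ξ _ _ _

theorem locForm_lin (x : M) (ξ : ImSplit) (z : E) :
    h.locForm x ξ z = (ξ : SplitQuaternion).imI • h.locForm x ImSplit.i z +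
      (ξ : SplitQuaternion).imJ • h.locForm x ImSplit.s z +
      (ξ : SplitQuaternion).imK • h.locForm x ImSplit.t z := by
  ext u v
  exact h.locForm_lin_apply x ξ z u v

theorem contDiffAt_locForm_of_smooth [FiniteDimensional ℝ E]
    {J : ∀ x : M, TangentSpace 𝓘(ℝ, E) x →L[ℝ] TangentSpace 𝓘(ℝ, E) x}
    (hJ : ContMDiff 𝓘(ℝ, E) (𝓘(ℝ, E).prod 𝓘(ℝ, E →L[ℝ] E)) ∞
    (fun x => TotalSpace.mk' (E →L[ℝ] E)
      (E := fun x : M => TangentSpace 𝓘(ℝ, E) x →L[ℝ] TangentSpace 𝓘(ℝ, E) x) x (J x)))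
    (x : M) (ξ : ImSplit) (hξ : ∀ (x : M) (u : TangentSpace 𝓘(ℝ, E) x), h.str ξ x u = J x u) :
    ContDiffAt ℝ ∞ (h.locForm x ξ) (extChartAt 𝓘(ℝ, E) x x) := by
  refine contDiffAt_clm_of_apply fun u => contDiffAt_clm_of_apply fun v => ?_
  have h1 := (contMDiffAt_iff.1 (h.contMDiffAt_g_apply hJ x u v)).2
  simp only [modelWithCornersSelf_coe, Set.range_id, contDiffWithinAt_univ] at h1
  refine h1.congr_of_eventuallyEq ?_
  filter_upwards [extChartAt_target_mem_nhds (I := 𝓘(ℝ, E)) x] with z hz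
  simp only [Function.comp_apply, extChartAt_model_space_eq_id, PartialEquiv.refl_coe, id]
  rw [(extChartAt 𝓘(ℝ, E) x).right_inv hz, locForm_apply]
  exact congrArg (fun w => h.g ((extChartAt 𝓘(ℝ, E) x).symm z) w (chartInvDeriv (E := E) x z v))
    (hξ ((extChartAt 𝓘(ℝ, E) x).symm z) (chartInvDeriv (E := E) x z u))

theorem contDiffAt_locForm [FiniteDimensional ℝ E] (x : M) (ξ : ImSplit) :
    ContDiffAt ℝ ∞ (h.locForm x ξ) (extChartAt 𝓘(ℝ, E) x x) := by
  have h1 := h.contDiffAt_locForm_of_smooth h.smooth_I x ImSplit.i h.str_i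
  have h2 := h.contDiffAt_locForm_of_smooth h.smooth_S x ImSplit.s h.str_s
  have h3 := h.contDiffAt_locForm_of_smooth h.smooth_T x ImSplit.t h.str_t
  have h4 : h.locForm x ξ = fun z => (ξ : SplitQuaternion).imI • h.locForm x ImSplit.i z +
      (ξ : SplitQuaternion).imJ • h.locForm x ImSplit.s z +
      (ξ : SplitQuaternion).imK • h.locForm x ImSplit.t z := funext (h.locForm_lin x ξ)
  rw [h4]
  exact contDiffAt_linearCombination _ _ _ h1 h2 h3

theorem differentiableAt_locForm [FiniteDimensional ℝ E] (x : M) (ξ : ImSplit) :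
    DifferentiableAt ℝ (h.locForm x ξ) (extChartAt 𝓘(ℝ, E) x x) :=
  (h.contDiffAt_locForm x ξ).differentiableAt (by simp)

theorem mExtDeriv_fundForm_apply [FiniteDimensional ℝ E] (x : M) (ξ : ImSplit) (u v w : E) :
    (show E [⋀^Fin 3]→L[ℝ] ℝ from mExtDeriv (h.fundForm ξ) x) ![u, v, w] =
      fderiv ℝ (h.locForm x ξ) (extChartAt 𝓘(ℝ, E) x x) u v w -
      fderiv ℝ (h.locForm x ξ) (extChartAt 𝓘(ℝ, E) x x) v u w +
      fderiv ℝ (h.locForm x ξ) (extChartAt 𝓘(ℝ, E) x x) w u v := by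
  refine (mExtDeriv_apply (h.fundForm ξ) x ![u, v, w]).trans ?_
  rw [extDeriv_twoForm_apply (h.differentiableAt_locForm x ξ)]
  · rfl
  · exact Filter.Eventually.of_forall fun z v => rfl

end AlmostHypersymplectic

namespace Hypersymplectic

variable {n : ℕ} {E : Type*} [NormedAddCommGroup E] [NormedSpace ℝ E] [FiniteDimensional ℝ E]
  {M : Type*} [TopologicalSpace M] [ChartedSpace E M] [IsManifold 𝓘(ℝ, E) ∞ M]
  (h : Hypersymplectic n E M)

-- Closedness is assumed only for the basis i, s, t; it spreads to every ξ because the components of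
-- ω_ξ are linear in ξ near the centre.
set_option synthInstance.maxHeartbeats 200000 in
theorem locForm_closed (x : M) (ξ : ImSplit) (u v w : E) :
    fderiv ℝ (h.locForm x ξ) (extChartAt 𝓘(ℝ, E) x x) u v w -
      fderiv ℝ (h.locForm x ξ) (extChartAt 𝓘(ℝ, E) x x) v u w +
      fderiv ℝ (h.locForm x ξ) (extChartAt 𝓘(ℝ, E) x x) w u v = 0 := by
  have h1 := h.mExtDeriv_fundForm_apply x ImSplit.i u v w
  have h2 := h.mExtDeriv_fundForm_apply x ImSplit.s u v w
  have h3 := h.mExtDeriv_fundForm_apply x ImSplit.t u v w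
  rw [h.closed_I] at h1
  rw [h.closed_S] at h2
  rw [h.closed_T] at h3
  have h4 : h.locForm x ξ = fun z => (ξ : SplitQuaternion).imI • h.locForm x ImSplit.i z +
      (ξ : SplitQuaternion).imJ • h.locForm x ImSplit.s z +
      (ξ : SplitQuaternion).imK • h.locForm x ImSplit.t z := funext (h.locForm_lin x ξ)
  have h6 : ∀ a b c, fderiv ℝ (h.locForm x ξ) (extChartAt 𝓘(ℝ, E) x x) a b c =
      (ξ : SplitQuaternion).imI *
        fderiv ℝ (h.locForm x ImSplit.i) (extChartAt 𝓘(ℝ, E) x x) a b c +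
      (ξ : SplitQuaternion).imJ *
        fderiv ℝ (h.locForm x ImSplit.s) (extChartAt 𝓘(ℝ, E) x x) a b c +
      (ξ : SplitQuaternion).imK *
        fderiv ℝ (h.locForm x ImSplit.t) (extChartAt 𝓘(ℝ, E) x x) a b c := by
    intro a b c
    rw [h4]
    exact congrArg (fun L : E →L[ℝ] E →L[ℝ] ℝ => L b c) (fderiv_linearCombination
      (G := E →L[ℝ] E →L[ℝ] ℝ) _ _ _
      (h.differentiableAt_locForm x ImSplit.i) (h.differentiableAt_locForm x ImSplit.s)
      (h.differentiableAt_locForm x ImSplit.t) a)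
  rw [h6, h6, h6]
  replace h1 : (0 : ℝ) = _ := h1
  replace h2 : (0 : ℝ) = _ := h2
  replace h3 : (0 : ℝ) = _ := h3
  linear_combination -(ξ : SplitQuaternion).imI * h1 - (ξ : SplitQuaternion).imJ * h2 -
    (ξ : SplitQuaternion).imK * h3

end Hypersymplectic

/-! ### One-parameter subgroups and the adjoint action -/

namespace ImSplit

theorem coe_expo_smul (t : ℝ) (ξ : ImSplit) :
    (expo (t • ξ) : SplitQuaternion) = NormedSpace.exp (t • (ξ : SplitQuaternion)) := rfl

theorem coe_expo_zero_smul (ξ : ImSplit) : (expo ((0 : ℝ) • ξ) : SplitQuaternion) = 1 := by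
  rw [coe_expo_smul, zero_smul, NormedSpace.exp_zero]

theorem expo_zero_smul (ξ : ImSplit) : expo ((0 : ℝ) • ξ) = 1 := Subtype.ext (coe_expo_zero_smul ξ)

theorem hasDerivAt_expo (ξ : ImSplit) :
    HasDerivAt (fun t : ℝ => (expo (t • ξ) : SplitQuaternion)) (ξ : SplitQuaternion) 0 := by
  have h := hasDerivAt_exp_smul_const (ξ : SplitQuaternion) (0 : ℝ)
  rwa [zero_smul, NormedSpace.exp_zero, one_mul] at h

theorem star_expo (ξ : ImSplit) (t : ℝ) :
    star (expo (t • ξ) : SplitQuaternion) = expo (t • (-ξ)) := by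
  rw [coe_expo_smul, coe_expo_smul, NormedSpace.star_exp, star_smul, skewAdjoint.mem_iff.1 ξ.2]
  rfl

theorem coe_Ad (q : SpOne) (ξ : ImSplit) :
    (Ad q ξ : SplitQuaternion) = (q : SplitQuaternion) * ξ * star (q : SplitQuaternion) := rfl

theorem Ad_Ad_inv (q : SpOne) (ξ : ImSplit) : Ad q (Ad q⁻¹ ξ) = ξ := by
  apply Subtype.ext
  rw [coe_Ad, coe_Ad, ← Unitary.star_eq_inv, Unitary.coe_star, star_star]
  have h : (q : SplitQuaternion) * star (q : SplitQuaternion) = 1 := Unitary.coe_mul_star_self q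
  calc (q : SplitQuaternion) * (star (q : SplitQuaternion) * ξ * q) * star (q : SplitQuaternion)
      = (q * star (q : SplitQuaternion)) * ξ * (q * star (q : SplitQuaternion)) := by
        simp only [mul_assoc]
    _ = ξ := by rw [h, one_mul, mul_one]

/-- This is the derivative of exp(−tη) ξ exp(tη). The inverse, which comes from pulling back, fixes
the order of the commutator as ξη − ηξ. -/
theorem hasDerivAt_Ad_expo_inv (ξ η : ImSplit) :
    HasDerivAt (fun t : ℝ => (Ad (expo (t • η))⁻¹ ξ : SplitQuaternion))
      (lie ξ η : SplitQuaternion) 0 := by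
  have h1 : (fun t : ℝ => (Ad (expo (t • η))⁻¹ ξ : SplitQuaternion)) =
      fun t : ℝ => (expo (t • (-η)) : SplitQuaternion) * ξ * (expo (t • η) : SplitQuaternion) := by
    funext t
    rw [coe_Ad, ← Unitary.star_eq_inv, Unitary.coe_star, star_star, star_expo]
  rw [h1]
  have h2 := ((hasDerivAt_expo (-η)).mul_const (ξ : SplitQuaternion)).fun_mul (hasDerivAt_expo η)
  rw [coe_expo_zero_smul, coe_expo_zero_smul, one_mul, mul_one] at h2
  refine h2.congr_deriv ?_
  change (-η : SplitQuaternion) * ξ + ξ * η = (ξ : SplitQuaternion) * η - η * ξ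
  noncomm_ring

/-- The exponential commutes with conjugation. This is what makes K equivariant under the group. -/
theorem Ad_inv_expo (q : SpOne) (ξ : ImSplit) (t : ℝ) :
    expo (t • ξ) * q = q * expo (t • Ad q⁻¹ ξ) := by
  let _ : NormedAlgebra ℚ SplitQuaternion := NormedAlgebra.restrictScalars ℚ ℝ SplitQuaternion
  have h0 : (q : SplitQuaternion) * star (q : SplitQuaternion) = 1 := Unitary.coe_mul_star_self q
  have h0' : star (q : SplitQuaternion) * (q : SplitQuaternion) = 1 := Unitary.coe_star_mul_self q
  -- Unitarity makes q a unit with inverse `star q`, so conjugation by q is conjugation by a unit.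
  let u : SplitQuaternionˣ := ⟨q, star q, h0, h0'⟩
  apply Subtype.ext
  have h : (t • (Ad q⁻¹ ξ : SplitQuaternion)) = ↑u⁻¹ * (t • (ξ : SplitQuaternion)) * ↑u := by
    rw [coe_Ad, ← Unitary.star_eq_inv, Unitary.coe_star, star_star, mul_smul_comm, smul_mul_assoc]
    rfl
  change (expo (t • ξ) : SplitQuaternion) * q = q * (expo (t • Ad q⁻¹ ξ) : SplitQuaternion)
  rw [coe_expo_smul, coe_expo_smul, h, NormedSpace.exp_units_conj']
  change _ = (q : SplitQuaternion) * (star (q : SplitQuaternion) * _ * q)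
  rw [mul_assoc (star (q : SplitQuaternion)), ← mul_assoc (q : SplitQuaternion), h0, one_mul]

theorem eventually_expo {Y : Type*} [TopologicalSpace Y] (z : Y) (ξ : ImSplit) {p : SplitQuaternion × Y → Prop}
    (hp : ∀ᶠ pz in 𝓝 ((1 : SplitQuaternion), z), p pz) :
    ∀ᶠ t in 𝓝 (0 : ℝ), p ((expo (t • ξ) : SplitQuaternion), z) := by
  have h1 : ContinuousAt (fun t : ℝ => ((expo (t • ξ) : SplitQuaternion), z)) 0 :=
    (hasDerivAt_expo ξ).continuousAt.prodMk continuousAt_const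
  refine h1.eventually ?_
  beta_reduce
  rwa [coe_expo_zero_smul]

end ImSplit

/-! ### The action as a smooth map in a chart, and its velocity fields -/

section LocalAction

variable {E : Type*} [NormedAddCommGroup E] [NormedSpace ℝ E]
  {M : Type*} [TopologicalSpace M] [ChartedSpace E M] [MulAction SpOne M]

/-- `F` is a smooth extension, near `(1, x)`, of the action read in the chart at `x`. -/
structure IsLocalAction (x : M) (F : SplitQuaternion × E → E) : Prop where
  contDiffAt : ContDiffAt ℝ ∞ F (1, extChartAt 𝓘(ℝ, E) x x)
  eventually_eq : ∀ᶠ pz in 𝓝 ((1 : SplitQuaternion), extChartAt 𝓘(ℝ, E) x x),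
    pz.2 ∈ (extChartAt 𝓘(ℝ, E) x).target ∧ ∀ q : SpOne, (q : SplitQuaternion) = pz.1 →
      q • (extChartAt 𝓘(ℝ, E) x).symm pz.2 ∈ (extChartAt 𝓘(ℝ, E) x).source ∧
      F pz = extChartAt 𝓘(ℝ, E) x (q • (extChartAt 𝓘(ℝ, E) x).symm pz.2)

namespace IsLocalAction

theorem eventually_one {x : M} {F : SplitQuaternion × E → E} (H : IsLocalAction x F) :
    ∀ᶠ z in 𝓝 (extChartAt 𝓘(ℝ, E) x x), F (1, z) = z := by
  have h1 : ContinuousAt (fun z : E => ((1 : SplitQuaternion), z)) (extChartAt 𝓘(ℝ, E) x x) := by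
    fun_prop
  filter_upwards [h1.eventually H.eventually_eq] with z hz
  rw [(hz.2 1 rfl).2, one_smul, (extChartAt 𝓘(ℝ, E) x).right_inv hz.1]

end IsLocalAction

variable [IsManifold 𝓘(ℝ, E) ∞ M]

/-- Take the smooth extension given at q₀ = 1 and conjugate it by the chart. It sends (1, x) to x,
so by continuity all domain conditions hold near (1, x). -/
theorem Hypersymplectic.IsPermutingAction.exists_isLocalAction {n : ℕ} {h : Hypersymplectic n E M}
    (hperm : h.IsPermutingAction) (x : M) :
    ∃ F : SplitQuaternion × E → E, IsLocalAction x F := by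
  obtain ⟨G, U, hU, hxU, hG, hGU⟩ := hperm.smooth 1 x
  let φ := extChartAt 𝓘(ℝ, E) x
  let ψ : SplitQuaternion × E → SplitQuaternion × M := fun pz => (pz.1, φ.symm pz.2)
  have hx : φ.symm (φ x) = x := extChartAt_to_inv x
  have hψ : ContMDiffAt 𝓘(ℝ, SplitQuaternion × E) (𝓘(ℝ, SplitQuaternion).prod 𝓘(ℝ, E)) ∞ ψ
      (1, φ x) := by
    refine ContMDiffAt.prodMk contDiffAt_fst.contMDiffAt ?_
    have h1 : ContMDiffAt 𝓘(ℝ, E) 𝓘(ℝ, E) ∞ φ.symm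
        (Prod.snd ((1 : SplitQuaternion), φ x)) := contMDiffAt_extChartAt_symm x
    exact h1.comp _ contDiffAt_snd.contMDiffAt
  have hψx : ψ (1, φ x) = (1, x) := by simp [ψ, hx]
  have hGx : G (1, x) = x := by
    have := hGU 1 x hxU
    simpa using this
  have hG' : ContMDiffAt (𝓘(ℝ, SplitQuaternion).prod 𝓘(ℝ, E)) 𝓘(ℝ, E) ∞ G (ψ (1, φ x)) := by
    rw [hψx]
    exact hG.contMDiffAt (hU.mem_nhds hxU)
  have hGψ := hG'.comp (1, φ x) hψ
  have hGψx : (G ∘ ψ) (1, φ x) = x := by rw [Function.comp_apply, hψx, hGx]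
  refine ⟨φ ∘ G ∘ ψ, ?_, ?_⟩
  · have hφ : ContMDiffAt 𝓘(ℝ, E) 𝓘(ℝ, E) ∞ φ ((G ∘ ψ) (1, φ x)) := by
      rw [hGψx]
      exact contMDiffAt_extChartAt
    exact (hφ.comp (1, φ x) hGψ).contDiffAt
  · have h1 : ∀ᶠ pz in 𝓝 ((1 : SplitQuaternion), φ x), pz.2 ∈ φ.target :=
      continuousAt_snd.eventually (show φ.target ∈ 𝓝 (φ x) from extChartAt_target_mem_nhds x)
    have h2 : ∀ᶠ pz in 𝓝 ((1 : SplitQuaternion), φ x), ψ pz ∈ U :=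
      hψ.continuousAt.eventually (hU.mem_nhds (by rw [hψx]; exact hxU))
    have h3 : ∀ᶠ pz in 𝓝 ((1 : SplitQuaternion), φ x), (G ∘ ψ) pz ∈ φ.source :=
      hGψ.continuousAt.eventually (by
        rw [hGψx]
        exact extChartAt_source_mem_nhds x)
    filter_upwards [h1, h2, h3] with pz hz1 hz2 hz3
    refine ⟨hz1, fun q hq => ?_⟩
    have h4 : (G ∘ ψ) pz = q • φ.symm pz.2 := by
      have := hGU q (φ.symm pz.2) (by rw [hq]; exact hz2)
      rw [← this, hq]
      rfl
    rw [← h4]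
    exact ⟨hz3, rfl⟩

namespace IsLocalAction

variable {x : M} {F : SplitQuaternion × E → E}

theorem hasMFDerivAt_curve (H : IsLocalAction x F) :
    ∀ᶠ z in 𝓝 (extChartAt 𝓘(ℝ, E) x x), ∀ ξ : ImSplit,
      HasMFDerivAt 𝓘(ℝ, ℝ) 𝓘(ℝ, E)
        (fun t : ℝ => ImSplit.expo (t • ξ) • (extChartAt 𝓘(ℝ, E) x).symm z) 0
        (show ℝ →L[ℝ] E from
          ContinuousLinearMap.toSpanSingleton ℝ (chartInvDeriv x z (velocity F 1 ξ z))) := by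
  have h1 : ContinuousAt (fun z : E => ((1 : SplitQuaternion), z)) (extChartAt 𝓘(ℝ, E) x x) := by
    fun_prop
  -- The order drops to 1 because being C¹ at a point is an open condition, while `ContDiffAt` of
  -- order ∞ need not persist at nearby points.
  have h2 : ∀ᶠ pz in 𝓝 ((1 : SplitQuaternion), extChartAt 𝓘(ℝ, E) x x), ContDiffAt ℝ 1 F pz :=
    (H.contDiffAt.of_le (by exact WithTop.coe_le_coe.2 le_top)).eventually (by simp)
  filter_upwards [h1.eventually (eventually_eventually_nhds.2 H.eventually_eq),
    h1.eventually h2, H.eventually_one] with z hz hz2 hz3 ξ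
  have hzt : z ∈ (extChartAt 𝓘(ℝ, E) x).target := hz.self_of_nhds.1
  have h3 := hasDerivAt_family (hz2.differentiableAt (by simp)) (ImSplit.hasDerivAt_expo ξ)
    (ImSplit.coe_expo_zero_smul ξ)
  have h4 : HasMFDerivAt 𝓘(ℝ, E) 𝓘(ℝ, E) (extChartAt 𝓘(ℝ, E) x).symm
      (F ((ImSplit.expo ((0 : ℝ) • ξ) : SplitQuaternion), z))
      (show E →L[ℝ] E from chartInvDeriv (E := E) x z) := by
    rw [ImSplit.coe_expo_zero_smul, hz3]
    exact hasMFDerivAt_extChartAt_symm hzt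
  have h5 := HasMFDerivAt.comp (0 : ℝ) h4 h3.hasFDerivAt.hasMFDerivAt
  refine (h5.congr_of_eventuallyEq ?_).congr_mfderiv ?_
  · filter_upwards [ImSplit.eventually_expo z ξ hz] with t ht
    have h6 := ht.2 (ImSplit.expo (t • ξ)) rfl
    rw [Function.comp_apply, h6.2, (extChartAt 𝓘(ℝ, E) x).left_inv h6.1]
  · exact ContinuousLinearMap.ext fun t => map_smul (chartInvDeriv x z) (show ℝ from t) _

/-- The identification of K_ξ with the velocity field holds on a whole neighbourhood of the centre;
equality at the centre alone could not be differentiated. -/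
theorem velocity_eq (H : IsLocalAction x F) :
    ∀ᶠ z in 𝓝 (extChartAt 𝓘(ℝ, E) x x), ∀ ξ : ImSplit,
      chartInvDeriv x z (velocity F 1 ξ z) =
        Hypersymplectic.fundVF E ξ ((extChartAt 𝓘(ℝ, E) x).symm z) := by
  filter_upwards [H.hasMFDerivAt_curve] with z hz ξ
  have h1 := (hz ξ).mfderiv
  have h2 := congrArg (fun L : ℝ →L[ℝ] E => L 1) h1
  have h3 : ContinuousLinearMap.toSpanSingleton ℝ (chartInvDeriv x z (velocity F 1 ξ z)) 1 =
    chartInvDeriv x z (velocity F 1 ξ z) := by simp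
  exact h3.symm.trans h2.symm

end IsLocalAction

end LocalAction

/-! ### Coordinate functionals on 𝔹 -/

namespace SplitQuaternion

/-- The coordinate functional `imI`. -/
def imICLM : SplitQuaternion →L[ℝ] ℝ :=
  LinearMap.toContinuousLinearMap
    { toFun := fun q => q.imI, map_add' := fun _ _ => rfl, map_smul' := fun _ _ => rfl }

/-- The coordinate functional `imJ`. -/
def imJCLM : SplitQuaternion →L[ℝ] ℝ :=
  LinearMap.toContinuousLinearMap
    { toFun := fun q => q.imJ, map_add' := fun _ _ => rfl, map_smul' := fun _ _ => rfl }

/-- The coordinate functional `imK`. -/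
def imKCLM : SplitQuaternion →L[ℝ] ℝ :=
  LinearMap.toContinuousLinearMap
    { toFun := fun q => q.imK, map_add' := fun _ _ => rfl, map_smul' := fun _ _ => rfl }

variable {f : ℝ → SplitQuaternion} {f' : SplitQuaternion} {t : ℝ}

theorem hasDerivAt_imI (hf : HasDerivAt f f' t) : HasDerivAt (fun s => (f s).imI) f'.imI t :=
  imICLM.hasFDerivAt.comp_hasDerivAt t hf

theorem hasDerivAt_imJ (hf : HasDerivAt f f' t) : HasDerivAt (fun s => (f s).imJ) f'.imJ t :=
  imJCLM.hasFDerivAt.comp_hasDerivAt t hf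

theorem hasDerivAt_imK (hf : HasDerivAt f f' t) : HasDerivAt (fun s => (f s).imK) f'.imK t :=
  imKCLM.hasFDerivAt.comp_hasDerivAt t hf

end SplitQuaternion

theorem ImSplit.coe_eq_linearCombination (ξ : ImSplit) : (ξ : SplitQuaternion) =
    (ξ : SplitQuaternion).imI • (ImSplit.i : SplitQuaternion) +
      (ξ : SplitQuaternion).imJ • (ImSplit.s : SplitQuaternion) +
      (ξ : SplitQuaternion).imK • (ImSplit.t : SplitQuaternion) := by
  ext <;> simp [ImSplit.i, ImSplit.s, ImSplit.t, ImSplit.re_eq_zero]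

/-! ### Differentials of group elements near 1 and equivariance of K -/

namespace IsLocalAction

variable {E : Type*} [NormedAddCommGroup E] [NormedSpace ℝ E]
  {M : Type*} [TopologicalSpace M] [ChartedSpace E M] [MulAction SpOne M]
  [IsManifold 𝓘(ℝ, E) ∞ M] {x : M} {F : SplitQuaternion × E → E}

theorem velocity_lin (y : E) (ξ : ImSplit) : velocity F 1 (ξ : SplitQuaternion) y =
    (ξ : SplitQuaternion).imI • velocity F 1 (ImSplit.i : SplitQuaternion) y +
      (ξ : SplitQuaternion).imJ • velocity F 1 (ImSplit.s : SplitQuaternion) y +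
      (ξ : SplitQuaternion).imK • velocity F 1 (ImSplit.t : SplitQuaternion) y := by
  have h : ∀ q : SplitQuaternion, velocity F 1 q y =
    (fderiv ℝ F (1, y)).comp (ContinuousLinearMap.inl ℝ SplitQuaternion E) q := fun q => rfl
  simp only [h]
  conv_lhs => rw [ξ.coe_eq_linearCombination]
  simp only [map_add, map_smul]

/-- The differential of the action of a group element close to `1`, read in the chart. -/
theorem eventually_hasMFDerivAt_smul (H : IsLocalAction x F) (η : ImSplit) :
    ∀ᶠ t in 𝓝 (0 : ℝ),
      F ((ImSplit.expo (t • η) : SplitQuaternion), extChartAt 𝓘(ℝ, E) x x) ∈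
        (extChartAt 𝓘(ℝ, E) x).target ∧
      (extChartAt 𝓘(ℝ, E) x).symm
        (F ((ImSplit.expo (t • η) : SplitQuaternion), extChartAt 𝓘(ℝ, E) x x)) =
        ImSplit.expo (t • η) • x ∧
      HasMFDerivAt 𝓘(ℝ, E) 𝓘(ℝ, E) (fun p : M => ImSplit.expo (t • η) • p) x
        (show E →L[ℝ] E from (chartInvDeriv (E := E) x
          (F ((ImSplit.expo (t • η) : SplitQuaternion), extChartAt 𝓘(ℝ, E) x x))).comp
          ((fderiv ℝ F ((ImSplit.expo (t • η) : SplitQuaternion), extChartAt 𝓘(ℝ, E) x x)).comp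
            (ContinuousLinearMap.inr ℝ SplitQuaternion E))) := by
  have h2 : ∀ᶠ pz in 𝓝 ((1 : SplitQuaternion), extChartAt 𝓘(ℝ, E) x x), ContDiffAt ℝ 1 F pz :=
    (H.contDiffAt.of_le (by exact WithTop.coe_le_coe.2 le_top)).eventually (by simp)
  filter_upwards [ImSplit.eventually_expo _ η (eventually_eventually_nhds.2 H.eventually_eq),
    ImSplit.eventually_expo _ η h2] with t ht ht2
  generalize ImSplit.expo (t • η) = q at ht ht2
  have h3 := ht.self_of_nhds.2 q rfl
  simp only [extChartAt_to_inv] at h3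
  have hmem : F ((q : SplitQuaternion), extChartAt 𝓘(ℝ, E) x x) ∈
      (extChartAt 𝓘(ℝ, E) x).target := by
    rw [h3.2]
    exact (extChartAt 𝓘(ℝ, E) x).map_source h3.1
  refine ⟨hmem, ?_, ?_⟩
  · rw [h3.2, (extChartAt 𝓘(ℝ, E) x).left_inv h3.1]
  · have h4 : HasFDerivAt (fun z => F ((q : SplitQuaternion), z))
        ((fderiv ℝ F ((q : SplitQuaternion), extChartAt 𝓘(ℝ, E) x x)).comp
            (ContinuousLinearMap.inr ℝ SplitQuaternion E)) (extChartAt 𝓘(ℝ, E) x x) :=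
      (ht2.differentiableAt (by simp)).hasFDerivAt.comp _ (hasFDerivAt_prodMk_right _ _)
    have h5 := HasMFDerivAt.comp x h4.hasMFDerivAt
      (hasMFDerivAt_extChartAt' (mem_extChartAt_source (I := 𝓘(ℝ, E)) x))
    have h6 := HasMFDerivAt.comp x (hasMFDerivAt_extChartAt_symm hmem) h5
    refine (h6.congr_of_eventuallyEq ?_).congr_mfderiv ?_
    · have h7 : ContinuousAt (fun p : M => ((q : SplitQuaternion), extChartAt 𝓘(ℝ, E) x p)) x :=
        continuousAt_const.prodMk (continuousAt_extChartAt x)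
      filter_upwards [h7.eventually ht, extChartAt_source_mem_nhds (I := 𝓘(ℝ, E)) x] with p hp hps
      have h8 := hp.2 q rfl
      simp only [(extChartAt 𝓘(ℝ, E) x).left_inv hps] at h8
      simp only [Function.comp_apply]
      rw [h8.2, (extChartAt 𝓘(ℝ, E) x).left_inv h8.1]
    · rw [chartDeriv_self]
      rfl

/-- By `Ad_inv_expo` the orbit curve of ξ through q • x is the q-translate of the orbit curve of
Ad_{q⁻¹} ξ through x; differentiate at 0. -/
theorem fundVF_smul (H : IsLocalAction x F) (q : SpOne)
    (hq : MDifferentiableAt 𝓘(ℝ, E) 𝓘(ℝ, E) (fun p : M => q • p) x) (ξ : ImSplit) :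
    Hypersymplectic.fundVF E ξ (q • x) = Hypersymplectic.dAct E q x
      (Hypersymplectic.fundVF E (ImSplit.Ad q⁻¹ ξ) x) := by
  have h1 := H.hasMFDerivAt_curve.self_of_nhds (ImSplit.Ad q⁻¹ ξ)
  rw [extChartAt_to_inv] at h1
  have h2 : HasMFDerivAt 𝓘(ℝ, E) 𝓘(ℝ, E) (fun p : M => q • p)
      ((fun t : ℝ => ImSplit.expo (t • ImSplit.Ad q⁻¹ ξ) • x) 0) (show E →L[ℝ] E from
        Hypersymplectic.dAct E q x) := by
    -- The curve at time 0 equals x only propositionally, so the derivative is carried along that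
    -- equality.
    have h0 : ∀ x' : M, x' = x → HasMFDerivAt 𝓘(ℝ, E) 𝓘(ℝ, E) (fun p : M => q • p) x'
        (show E →L[ℝ] E from Hypersymplectic.dAct E q x) := by
      rintro _ rfl
      exact hq.hasMFDerivAt
    exact h0 _ (by simp only [ImSplit.expo_zero_smul, one_smul])
  have h3 := HasMFDerivAt.comp (0 : ℝ) h2 h1
  have h4 : (fun t : ℝ => ImSplit.expo (t • ξ) • q • x) =
      (fun p : M => q • p) ∘ fun t : ℝ => ImSplit.expo (t • ImSplit.Ad q⁻¹ ξ) • x := by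
    funext t
    rw [Function.comp_apply, ← mul_smul, ← mul_smul, ImSplit.Ad_inv_expo]
  have h5 := h3.mfderiv
  rw [← h4] at h5
  have h6 := h1.mfderiv
  have h7 : (Hypersymplectic.fundVF E ξ (q • x) : E) = (show E →L[ℝ] E from
      Hypersymplectic.dAct E q x) ((show ℝ →L[ℝ] E from
          ContinuousLinearMap.toSpanSingleton ℝ
            (chartInvDeriv x (extChartAt 𝓘(ℝ, E) x x)
              (velocity F 1 (ImSplit.Ad q⁻¹ ξ : SplitQuaternion) (extChartAt 𝓘(ℝ, E) x x)))) 1) :=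
    congrArg (fun L : ℝ →L[ℝ] E => L 1) h5
  have h8 := congrArg (fun L : ℝ →L[ℝ] E => L 1) h6
  exact h7.trans (congrArg (show E →L[ℝ] E from Hypersymplectic.dAct E q x) h8.symm)

end IsLocalAction

/-! ### Equivariance of ω_ξ and K_ξ under group elements, in the chart -/

namespace Hypersymplectic

variable {n : ℕ} {E : Type*} [NormedAddCommGroup E] [NormedSpace ℝ E]
  {M : Type*} [TopologicalSpace M] [ChartedSpace E M] [IsManifold 𝓘(ℝ, E) ∞ M]

/-- All tangent spaces are definitionally E, so vectors over propositionally equal base points can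
be compared inside E without transport. -/
theorem g_str_congr (h : Hypersymplectic n E M) (ξ : ImSplit) {p p' : M} (hp : p = p')
    {a a' b b' : E} (ha : a = a') (hb : b = b') :
    h.g p (h.str ξ p a) b = h.g p' (h.str ξ p' a') b' := by
  subst hp ha hb
  rfl

theorem locForm_self (h : Hypersymplectic n E M) (x : M) (ξ : ImSplit) (u v : E) :
    h.locForm x ξ (extChartAt 𝓘(ℝ, E) x x) u v = h.g x (h.str ξ x u) v := by
  rw [AlmostHypersymplectic.locForm_apply]
  refine h.g_str_congr ξ (extChartAt_to_inv x) ?_ ?_ <;> rw [chartInvDeriv_self] <;> rfl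

variable [MulAction SpOne M] {h : Hypersymplectic n E M} {x : M} {F : SplitQuaternion × E → E}

/-- The finite law q^*ω_ξ = ω_{Ad_{q⁻¹} ξ}: move 𝕀 through q_* by the permuting property, then drop
q_* by isometry. -/
theorem IsPermutingAction.g_str_smul (hperm : h.IsPermutingAction) (q : SpOne) (ξ : ImSplit)
    (u v : TangentSpace 𝓘(ℝ, E) x) :
    h.g (q • x) (h.str ξ (q • x) (dAct E q x u)) (dAct E q x v) =
      h.g x (h.str (ImSplit.Ad q⁻¹ ξ) x u) v := by
  conv_lhs => rw [← ImSplit.Ad_Ad_inv q ξ]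
  rw [← hperm.permuting, hperm.isometric]

theorem IsPermutingAction.locForm_pullback (hperm : h.IsPermutingAction) (H : IsLocalAction x F)
    (ξ η : ImSplit) (u v : E) :
    ∀ᶠ t in 𝓝 (0 : ℝ),
      h.locForm x ξ (F ((ImSplit.expo (t • η) : SplitQuaternion), extChartAt 𝓘(ℝ, E) x x))
        ((fderiv ℝ F ((ImSplit.expo (t • η) : SplitQuaternion), extChartAt 𝓘(ℝ, E) x x)).comp
            (ContinuousLinearMap.inr ℝ SplitQuaternion E) u)
        ((fderiv ℝ F ((ImSplit.expo (t • η) : SplitQuaternion), extChartAt 𝓘(ℝ, E) x x)).comp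
            (ContinuousLinearMap.inr ℝ SplitQuaternion E) v) =
      h.locForm x (ImSplit.Ad (ImSplit.expo (t • η))⁻¹ ξ) (extChartAt 𝓘(ℝ, E) x x) u v := by
  filter_upwards [H.eventually_hasMFDerivAt_smul η] with t ht
  rw [locForm_self, ← hperm.g_str_smul (ImSplit.expo (t • η)) ξ u v,
    AlmostHypersymplectic.locForm_apply]
  have h1 := ht.2.2.mfderiv
  exact h.g_str_congr ξ ht.2.1 (congrArg (fun L : E →L[ℝ] E => L u) h1).symm
    (congrArg (fun L : E →L[ℝ] E => L v) h1).symm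

theorem velocity_self (H : IsLocalAction x F) (ξ : ImSplit) :
    velocity F 1 (ξ : SplitQuaternion) (extChartAt 𝓘(ℝ, E) x x) = (fundVF E ξ x : E) := by
  have h1 := H.velocity_eq.self_of_nhds ξ
  rw [chartInvDeriv_self] at h1
  have h2 : ∀ p p' : M, p = p' → (fundVF E ξ p : E) = (fundVF E ξ p' : E) := by
    rintro p _ rfl
    rfl
  exact h1.trans (h2 _ _ (extChartAt_to_inv x))

theorem velocity_pushforward (H : IsLocalAction x F) (ξ η : ImSplit) :
    ∀ᶠ t in 𝓝 (0 : ℝ),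
      velocity F 1 (ξ : SplitQuaternion)
        (F ((ImSplit.expo (t • η) : SplitQuaternion), extChartAt 𝓘(ℝ, E) x x)) =
      (fderiv ℝ F ((ImSplit.expo (t • η) : SplitQuaternion), extChartAt 𝓘(ℝ, E) x x)).comp
            (ContinuousLinearMap.inr ℝ SplitQuaternion E)
        (velocity F 1 (ImSplit.Ad (ImSplit.expo (t • η))⁻¹ ξ : SplitQuaternion)
          (extChartAt 𝓘(ℝ, E) x x)) := by
  have h0 : ContinuousAt F (1, extChartAt 𝓘(ℝ, E) x x) := H.contDiffAt.continuousAt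
  have h00 : F (1, extChartAt 𝓘(ℝ, E) x x) = extChartAt 𝓘(ℝ, E) x x := H.eventually_one.self_of_nhds
  have h1 := ImSplit.eventually_expo (extChartAt 𝓘(ℝ, E) x x) η
    (h0.eventually (by rw [h00]; exact H.velocity_eq))
  filter_upwards [H.eventually_hasMFDerivAt_smul η, h1] with t ht ht2
  -- Both sides are compared on M, where they become K_ξ at the moved point and the push-forward of
  -- K_{Ad_{q⁻¹} ξ}.
  apply chartInvDeriv_injective ht.1
  rw [ht2 ξ, velocity_self H]
  have h2 : ∀ p p' : M, p = p' → (fundVF E ξ p : E) = (fundVF E ξ p' : E) := by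
    rintro p _ rfl
    rfl
  refine (h2 _ _ ht.2.1).trans ?_
  refine (H.fundVF_smul (ImSplit.expo (t • η)) ht.2.2.mdifferentiableAt ξ).trans ?_
  exact congrArg (fun L : E →L[ℝ] E => L (fundVF E (ImSplit.Ad (ImSplit.expo (t • η))⁻¹ ξ) x))
    ht.2.2.mfderiv

end Hypersymplectic

/-! ### Smoothness and derivatives of functions given in a chart -/

section ChartFunctions

variable {E : Type*} [NormedAddCommGroup E] [NormedSpace ℝ E]
  {M : Type*} [TopologicalSpace M] [ChartedSpace E M] {x : M}

theorem contMDiffAt_of_eventually_symm {f : M → ℝ} {r : E → ℝ}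
    (hr : ContDiffAt ℝ ∞ r (extChartAt 𝓘(ℝ, E) x x))
    (hfr : ∀ᶠ z in 𝓝 (extChartAt 𝓘(ℝ, E) x x), f ((extChartAt 𝓘(ℝ, E) x).symm z) = r z) :
    ContMDiffAt 𝓘(ℝ, E) 𝓘(ℝ, ℝ) ∞ f x := by
  have h1 : ContMDiffAt 𝓘(ℝ, E) 𝓘(ℝ, ℝ) ∞ (r ∘ extChartAt 𝓘(ℝ, E) x) x :=
    hr.contMDiffAt.comp x contMDiffAt_extChartAt
  refine h1.congr_of_eventuallyEq ?_
  filter_upwards [(continuousAt_extChartAt x).eventually hfr,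
    extChartAt_source_mem_nhds (I := 𝓘(ℝ, E)) x] with p hp hps
  rw [(extChartAt 𝓘(ℝ, E) x).left_inv hps] at hp
  exact hp

variable [IsManifold 𝓘(ℝ, E) ∞ M]

theorem hasMFDerivAt_of_eventually_symm {f : M → ℝ} {r : E → ℝ} {r' : E →L[ℝ] ℝ}
    (hr : HasFDerivAt r r' (extChartAt 𝓘(ℝ, E) x x))
    (hfr : ∀ᶠ z in 𝓝 (extChartAt 𝓘(ℝ, E) x x), f ((extChartAt 𝓘(ℝ, E) x).symm z) = r z) :
    HasMFDerivAt 𝓘(ℝ, E) 𝓘(ℝ, ℝ) f x r' := by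
  have h1 := HasMFDerivAt.comp x hr.hasMFDerivAt
    (hasMFDerivAt_extChartAt' (mem_extChartAt_source (I := 𝓘(ℝ, E)) x))
  refine (h1.congr_of_eventuallyEq ?_).congr_mfderiv ?_
  · filter_upwards [(continuousAt_extChartAt x).eventually hfr,
      extChartAt_source_mem_nhds (I := 𝓘(ℝ, E)) x] with p hp hps
    rw [(extChartAt 𝓘(ℝ, E) x).left_inv hps] at hp
    exact hp
  · rw [chartDeriv_self]
    rfl

end ChartFunctions

/-! ### Infinitesimal equivariance and the construction of the local model -/

namespace Hypersymplectic

variable {n : ℕ} {E : Type*} [NormedAddCommGroup E] [NormedSpace ℝ E]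
  {M : Type*} [TopologicalSpace M] [ChartedSpace E M] [IsManifold 𝓘(ℝ, E) ∞ M]

theorem hasDerivAt_locForm_Ad (h : Hypersymplectic n E M) (x : M) (ξ η : ImSplit) (z u v : E) :
    HasDerivAt (fun t : ℝ => h.locForm x (ImSplit.Ad (ImSplit.expo (t • η))⁻¹ ξ) z u v)
      (h.locForm x (ImSplit.lie ξ η) z u v) 0 := by
  have h0 := ImSplit.hasDerivAt_Ad_expo_inv ξ η
  have h1 : ∀ ζ : ImSplit, h.locForm x ζ z u v =
      (ζ : SplitQuaternion).imI * h.locForm x ImSplit.i z u v +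
      (ζ : SplitQuaternion).imJ * h.locForm x ImSplit.s z u v +
      (ζ : SplitQuaternion).imK * h.locForm x ImSplit.t z u v := fun ζ =>
    h.locForm_lin_apply x ζ z u v
  simp only [h1 (ImSplit.Ad _ _), h1 (ImSplit.lie _ _)]
  exact (((SplitQuaternion.hasDerivAt_imI h0).mul_const _).fun_add
    ((SplitQuaternion.hasDerivAt_imJ h0).mul_const _)).fun_add
    ((SplitQuaternion.hasDerivAt_imK h0).mul_const _)

variable [MulAction SpOne M] {h : Hypersymplectic n E M} {x : M} {F : SplitQuaternion × E → E}

theorem hasDerivAt_velocity_Ad (z : E) (ξ η : ImSplit) :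
    HasDerivAt (fun t : ℝ => velocity F 1
      (ImSplit.Ad (ImSplit.expo (t • η))⁻¹ ξ : SplitQuaternion) z)
      (velocity F 1 (ImSplit.lie ξ η : SplitQuaternion) z) 0 :=
  ((fderiv ℝ F (1, z)).comp (ContinuousLinearMap.inl ℝ SplitQuaternion E)).hasFDerivAt.comp_hasDerivAt
    (0 : ℝ) (ImSplit.hasDerivAt_Ad_expo_inv ξ η)

/-- Differentiate `locForm_pullback` at t = 0: one side gives the Lie derivative of ω_ξ along K_η,
the other the derivative of Ad. Uniqueness of derivatives equates them. -/
theorem IsPermutingAction.lie_locForm [FiniteDimensional ℝ E] (hperm : h.IsPermutingAction)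
    (H : IsLocalAction x F) (ξ η : ImSplit) (u v : E) :
    fderiv ℝ (h.locForm x ξ) (extChartAt 𝓘(ℝ, E) x x)
        (velocity F 1 (η : SplitQuaternion) (extChartAt 𝓘(ℝ, E) x x)) u v +
      h.locForm x ξ (extChartAt 𝓘(ℝ, E) x x) (fderiv ℝ (velocity F 1 (η : SplitQuaternion))
        (extChartAt 𝓘(ℝ, E) x x) u) v +
      h.locForm x ξ (extChartAt 𝓘(ℝ, E) x x) u (fderiv ℝ (velocity F 1 (η : SplitQuaternion))
        (extChartAt 𝓘(ℝ, E) x x) v) =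
      h.locForm x (ImSplit.lie ξ η) (extChartAt 𝓘(ℝ, E) x x) u v := by
  have hF0 : F ((ImSplit.expo ((0 : ℝ) • η) : SplitQuaternion), extChartAt 𝓘(ℝ, E) x x) =
      extChartAt 𝓘(ℝ, E) x x := by
    rw [ImSplit.coe_expo_zero_smul]
    exact H.eventually_one.self_of_nhds
  have hL0 : (fderiv ℝ F ((ImSplit.expo ((0 : ℝ) • η) : SplitQuaternion),
      extChartAt 𝓘(ℝ, E) x x)).comp (ContinuousLinearMap.inr ℝ SplitQuaternion E) =
      ContinuousLinearMap.id ℝ E := by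
    rw [ImSplit.coe_expo_zero_smul]
    exact fderiv_family_inr H.contDiffAt H.eventually_one
  have hc := hasDerivAt_family (H.contDiffAt.differentiableAt (by simp)) (ImSplit.hasDerivAt_expo η)
    (ImSplit.coe_expo_zero_smul η)
  have hL := hasDerivAt_fderiv_family H.contDiffAt (ImSplit.hasDerivAt_expo η)
    (ImSplit.coe_expo_zero_smul η)
  have h1 := hasDerivAt_pullback_form (h.differentiableAt_locForm x ξ) hc hF0 hL hL0 u v
  have h2 := (h.hasDerivAt_locForm_Ad x ξ η _ u v).congr_of_eventuallyEq
    (hperm.locForm_pullback H ξ η u v)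
  exact h1.unique h2

/-- Differentiate `velocity_pushforward` at t = 0. The product rule on the right gives the
derivative of K_η along K_ξ, from the moving differential, plus the bracket term from Ad. -/
theorem lie_velocity (H : IsLocalAction x F) (ξ η : ImSplit) :
    fderiv ℝ (velocity F 1 (ξ : SplitQuaternion)) (extChartAt 𝓘(ℝ, E) x x)
        (velocity F 1 (η : SplitQuaternion) (extChartAt 𝓘(ℝ, E) x x)) -
      fderiv ℝ (velocity F 1 (η : SplitQuaternion)) (extChartAt 𝓘(ℝ, E) x x)
        (velocity F 1 (ξ : SplitQuaternion) (extChartAt 𝓘(ℝ, E) x x)) =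
      velocity F 1 (ImSplit.lie ξ η : SplitQuaternion) (extChartAt 𝓘(ℝ, E) x x) := by
  have hF0 : F ((ImSplit.expo ((0 : ℝ) • η) : SplitQuaternion), extChartAt 𝓘(ℝ, E) x x) =
      extChartAt 𝓘(ℝ, E) x x := by
    rw [ImSplit.coe_expo_zero_smul]
    exact H.eventually_one.self_of_nhds
  have hL0 : (fderiv ℝ F ((ImSplit.expo ((0 : ℝ) • η) : SplitQuaternion),
      extChartAt 𝓘(ℝ, E) x x)).comp (ContinuousLinearMap.inr ℝ SplitQuaternion E) =
      ContinuousLinearMap.id ℝ E := by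
    rw [ImSplit.coe_expo_zero_smul]
    exact fderiv_family_inr H.contDiffAt H.eventually_one
  have hξ0 : ImSplit.Ad (ImSplit.expo ((0 : ℝ) • η))⁻¹ ξ = ξ := by
    rw [ImSplit.expo_zero_smul, inv_one]
    exact Subtype.ext (by rw [ImSplit.coe_Ad, OneMemClass.coe_one, star_one, one_mul, mul_one])
  have h1 : DifferentiableAt ℝ (velocity F 1 (ξ : SplitQuaternion))
      (F ((ImSplit.expo ((0 : ℝ) • η) : SplitQuaternion), extChartAt 𝓘(ℝ, E) x x)) := by
    rw [hF0]
    exact (contDiffAt_velocity H.contDiffAt _).differentiableAt (by simp)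
  have h2 := h1.hasFDerivAt.comp_hasDerivAt (0 : ℝ)
    (hasDerivAt_family (H.contDiffAt.differentiableAt (by simp)) (ImSplit.hasDerivAt_expo η)
      (ImSplit.coe_expo_zero_smul η))
  have h3 := (hasDerivAt_fderiv_family H.contDiffAt (ImSplit.hasDerivAt_expo η)
      (ImSplit.coe_expo_zero_smul η)).clm_apply
      (hasDerivAt_velocity_Ad (F := F) (extChartAt 𝓘(ℝ, E) x x) ξ η)
  have h4 := h2.unique (h3.congr_of_eventuallyEq (velocity_pushforward H ξ η))
  rw [hF0, hL0, hξ0] at h4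
  rw [h4]
  simp

theorem IsPermutingAction.localModel [FiniteDimensional ℝ E] (hperm : h.IsPermutingAction)
    (H : IsLocalAction x F) :
    LocalModel (h.locForm x) (fun ξ => velocity F 1 (ξ : SplitQuaternion))
      (extChartAt 𝓘(ℝ, E) x x) where
  diff_w ξ := h.differentiableAt_locForm x ξ
  diff_k ξ := (contDiffAt_velocity H.contDiffAt _).differentiableAt (by simp)
  skew ξ := h.locForm_skew x ξ _
  w_lin ξ u v := h.locForm_lin_apply x ξ _ u v
  k_lin ξ := IsLocalAction.velocity_lin _ ξ
  closed ξ := h.locForm_closed x ξ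
  lie_w := hperm.lie_locForm H
  lie_k := lie_velocity H

/-! ### The forms `γ`, `γ₁` and the functions `ρ` in a chart -/

theorem locγ_eq (H : IsLocalAction x F) :
    ∀ᶠ z in 𝓝 (extChartAt 𝓘(ℝ, E) x x), ∀ (ξ η : ImSplit) (u : E),
      h.γ ξ η ((extChartAt 𝓘(ℝ, E) x).symm z) (chartInvDeriv (E := E) x z u) =
        locγ (h.locForm x) (fun ξ => velocity F 1 (ξ : SplitQuaternion)) ξ η z u := by
  filter_upwards [H.velocity_eq] with z hz ξ η u
  exact congrArg (fun a => (1 / 2 : ℝ) * a) (h.g_str_congr ξ rfl (hz η).symm rfl)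

theorem locγ₁_eq (H : IsLocalAction x F) :
    ∀ᶠ z in 𝓝 (extChartAt 𝓘(ℝ, E) x x), ∀ (ζ : ImSplit) (u : E),
      h.γ₁ ζ ((extChartAt 𝓘(ℝ, E) x).symm z) (chartInvDeriv (E := E) x z u) =
        locγ₁ (h.locForm x) (fun ξ => velocity F 1 (ξ : SplitQuaternion)) ζ z u := by
  filter_upwards [locγ_eq (h := h) H] with z hz ζ u
  have h1 : ∀ ξ η : ImSplit,
      h.altγ ξ η ((extChartAt 𝓘(ℝ, E) x).symm z) (chartInvDeriv (E := E) x z u) =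
        locAltγ (h.locForm x) (fun ξ => velocity F 1 (ξ : SplitQuaternion)) ξ η z u := by
    intro ξ η
    exact congrArg₂ (fun a b => (1 / 2 : ℝ) * (a - b)) (hz ξ η u) (hz η ξ u)
  have h2 : ∀ a a' b b' c c' : ℝ, a = a' → b = b' → c = c' →
      -((ζ : SplitQuaternion).imI * a) + (ζ : SplitQuaternion).imJ * b +
        (ζ : SplitQuaternion).imK * c = -((ζ : SplitQuaternion).imI * a') +
        (ζ : SplitQuaternion).imJ * b' + (ζ : SplitQuaternion).imK * c' := by
    rintro a _ b _ c _ rfl rfl rfl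
    rfl
  exact h2 _ _ _ _ _ _ (h1 _ _) (h1 _ _) (h1 _ _)

theorem locρ_eq (H : IsLocalAction x F) (ξ η : ImSplit) :
    ∀ᶠ z in 𝓝 (extChartAt 𝓘(ℝ, E) x x),
      h.ρ ξ η ((extChartAt 𝓘(ℝ, E) x).symm z) =
        locγ₁ (h.locForm x) (fun ξ => velocity F 1 (ξ : SplitQuaternion)) ξ z
          (velocity F 1 (η : SplitQuaternion) z) := by
  filter_upwards [locγ₁_eq (h := h) H, H.velocity_eq] with z hz hz2
  rw [← hz]
  exact congrArg (h.γ₁ ξ ((extChartAt 𝓘(ℝ, E) x).symm z)) (hz2 η).symm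

theorem γ_self (H : IsLocalAction x F) (ξ η : ImSplit) (u : E) :
    locγ (h.locForm x) (fun ξ => velocity F 1 (ξ : SplitQuaternion)) ξ η
      (extChartAt 𝓘(ℝ, E) x x) u = h.γ ξ η x u := by
  change (1 / 2 : ℝ) * h.locForm x ξ (extChartAt 𝓘(ℝ, E) x x)
    (velocity F 1 (η : SplitQuaternion) (extChartAt 𝓘(ℝ, E) x x)) u = _
  rw [locForm_self, velocity_self H]
  rfl

theorem contDiffAt_locγ [FiniteDimensional ℝ E] (h : Hypersymplectic n E M)
    (H : IsLocalAction x F) (ξ η : ImSplit) :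
    ContDiffAt ℝ ∞ (locγ (h.locForm x) (fun ξ => velocity F 1 (ξ : SplitQuaternion)) ξ η)
      (extChartAt 𝓘(ℝ, E) x x) :=
  ContDiffAt.const_smul _ ((h.contDiffAt_locForm x ξ).clm_apply (contDiffAt_velocity H.contDiffAt _))

theorem contDiffAt_locγ₁ [FiniteDimensional ℝ E] (h : Hypersymplectic n E M)
    (H : IsLocalAction x F) (ζ : ImSplit) :
    ContDiffAt ℝ ∞ (locγ₁ (h.locForm x) (fun ξ => velocity F 1 (ξ : SplitQuaternion)) ζ)
      (extChartAt 𝓘(ℝ, E) x x) := by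
  have h1 : ∀ ξ η, ContDiffAt ℝ ∞
      (locAltγ (h.locForm x) (fun ξ => velocity F 1 (ξ : SplitQuaternion)) ξ η)
      (extChartAt 𝓘(ℝ, E) x x) := fun ξ η =>
    ContDiffAt.const_smul _ ((h.contDiffAt_locγ H ξ η).sub (h.contDiffAt_locγ H η ξ))
  exact ((ContDiffAt.const_smul _ (h1 _ _)).neg.add (ContDiffAt.const_smul _ (h1 _ _))).add
    (ContDiffAt.const_smul _ (h1 _ _))

theorem IsPermutingAction.contMDiff_ρ [FiniteDimensional ℝ E] (hperm : h.IsPermutingAction)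
    (ξ η : ImSplit) : ContMDiff 𝓘(ℝ, E) 𝓘(ℝ, ℝ) ∞ (h.ρ ξ η) := by
  intro x
  obtain ⟨F, H⟩ := hperm.exists_isLocalAction x
  exact contMDiffAt_of_eventually_symm
    ((h.contDiffAt_locγ₁ H ξ).clm_apply (contDiffAt_velocity H.contDiffAt _)) (locρ_eq H ξ η)

/-- `d ρ(ξ, η) = -γ(ξ, η) - γ(η, ξ)`. -/
theorem IsPermutingAction.hasMFDerivAt_ρ [FiniteDimensional ℝ E] (hperm : h.IsPermutingAction)
    (ξ η : ImSplit) (x : M) :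
    HasMFDerivAt 𝓘(ℝ, E) 𝓘(ℝ, ℝ) (h.ρ ξ η) x
      (show E →L[ℝ] ℝ from -h.γ ξ η x - h.γ η ξ x) := by
  obtain ⟨F, H⟩ := hperm.exists_isLocalAction x
  refine (hasMFDerivAt_of_eventually_symm ((hperm.localModel H).hasFDerivAt_locρ ξ η)
    -- The derivative is known in the chart; at the centre it agrees with the invariant expression
    -- in γ.
    (locρ_eq H ξ η)).congr_mfderiv ?_
  refine ContinuousLinearMap.ext fun u => ?_
  exact congrArg₂ (fun a b : ℝ => -a - b) (γ_self H ξ η u) (γ_self H η ξ u)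

/-- `d γ₁(ζ) = ω_ζ`. -/
theorem IsPermutingAction.mExtDeriv_γ₁ [FiniteDimensional ℝ E] (hperm : h.IsPermutingAction)
    (ζ : ImSplit) (x : M) :
    mExtDeriv (fun y : M => ContinuousAlternatingMap.ofSubsingleton ℝ (TangentSpace 𝓘(ℝ, E) y) ℝ
      (0 : Fin 1) (h.γ₁ ζ y)) x = h.fundForm ζ x := by
  obtain ⟨F, H⟩ := hperm.exists_isLocalAction x
  refine ContinuousAlternatingMap.ext fun v => ?_
  refine (mExtDeriv_apply (E := E) (fun y : M => ContinuousAlternatingMap.ofSubsingleton ℝ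
    (TangentSpace 𝓘(ℝ, E) y) ℝ (0 : Fin 1) (h.γ₁ ζ y)) x v).trans ?_
  refine (extDeriv_oneForm_apply
    ((hperm.localModel H).hasFDerivAt_locγ₁ ζ).differentiableAt ?_ v).trans ?_
  · filter_upwards [locγ₁_eq (h := h) H] with z hz v
    exact hz ζ (v 0)
  · exact ((hperm.localModel H).d_locγ₁ ζ (v 0) (v 1)).trans (h.locForm_self x ζ (v 0) (v 1))

end Hypersymplectic

/-! ### Pointwise algebra of g and the endomorphisms 𝕀_ξ -/

namespace AlmostHypersymplectic

variable {n : ℕ} {E : Type*} [NormedAddCommGroup E] [NormedSpace ℝ E]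
  {M : Type*} [TopologicalSpace M] [ChartedSpace E M] [IsManifold 𝓘(ℝ, E) ∞ M]
  (h : AlmostHypersymplectic n E M)

/-- Split u = p + m along P and N, which need not be orthogonal. Pairing u with p and with m gives
g(p,p) = −g(m,p) = g(m,m), and definiteness of opposite signs forces both parts to vanish. -/
theorem eq_zero_of_forall_g_eq_zero {x : M} {u : TangentSpace 𝓘(ℝ, E) x}
    (hu : ∀ v, h.g x u v = 0) : u = 0 := by
  obtain ⟨P, N, hPN, -, -, hP, hN⟩ := h.neutral x
  obtain ⟨p, hp, m, hm, rfl⟩ := Submodule.mem_sup.1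
    (show u ∈ P ⊔ N by rw [hPN.sup_eq_top]; exact Submodule.mem_top)
  have h1 := hu p
  have h2 := hu m
  rw [map_add, add_apply] at h1 h2
  have h3 := h.symm x m p
  have hp0 : p = 0 := by
    by_contra hne
    have h4 := hP p hp hne
    by_cases hm0 : m = 0
    · rw [hm0, map_zero, zero_apply] at h1
      linarith
    · have h5 := hN m hm hm0
      linarith
  have hm0 : m = 0 := by
    by_contra hne
    have h5 := hN m hm hne
    rw [hp0, map_zero, zero_apply] at h2
    linarith
  rw [hp0, hm0, add_zero]

theorem S_T (x : M) (u : TangentSpace 𝓘(ℝ, E) x) : h.S x (h.T x u) = -h.I x u := by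
  have h1 : h.S x (h.T x u) = h.S x (h.I x (h.S x u)) := by rw [h.I_S]
  rw [h1, h.S_I, h.T_S]

theorem I_T (x : M) (u : TangentSpace 𝓘(ℝ, E) x) : h.I x (h.T x u) = -h.S x u := by
  rw [← h.I_S, h.I_I]

theorem T_I (x : M) (u : TangentSpace 𝓘(ℝ, E) x) : h.T x (h.I x u) = h.S x u := by
  rw [← h.T_S, h.T_T]

theorem str_str_self (ξ : ImSplit) (x : M) (u : TangentSpace 𝓘(ℝ, E) x) :
    h.str ξ x (h.str ξ x u) = -(ξ.nsq • u) := by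
  rw [ImSplit.nsq_eq, ImSplit.bform_eq]
  simp only [str_apply, map_add, map_smul, h.I_I, h.I_S, h.I_T, h.S_I, h.S_S, h.S_T, h.T_I, h.T_S,
    h.T_T]
  module

/-- The cross terms vanish: each of g(Su,Tu), g(Iu,Tu), g(Iu,Su) is, up to sign, some ω_ζ evaluated
on a repeated vector. The diagonal terms carry the signs of ⟨·,·⟩. -/
theorem g_str_str (ξ η : ImSplit) (x : M) (u : TangentSpace 𝓘(ℝ, E) x) :
    h.g x (h.str ξ x u) (h.str η x u) = ImSplit.bform ξ η * h.g x u u := by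
  rw [ImSplit.bform_eq]
  have e1 := h.g_I x u u
  have e2 := h.g_S x u u
  have e3 := h.g_T x u u
  have e4 : h.g x (h.S x u) (h.T x u) = 0 := by
    have := h.g_str_self ImSplit.i x (h.S x u)
    rw [h.str_i, h.I_S] at this
    rw [h.symm, this]
  have e5 : h.g x (h.I x u) (h.T x u) = 0 := by
    have := h.g_str_self ImSplit.s x (h.I x u)
    rw [h.str_s, h.S_I, map_neg, neg_apply] at this
    rw [h.symm]
    linarith
  have e6 : h.g x (h.I x u) (h.S x u) = 0 := by
    have := h.g_str_self ImSplit.t x (h.S x u)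
    rw [h.str_t, h.T_S] at this
    exact this
  have e4' := (h.symm x (h.T x u) (h.S x u)).trans e4
  have e5' := (h.symm x (h.T x u) (h.I x u)).trans e5
  have e6' := (h.symm x (h.S x u) (h.I x u)).trans e6
  simp only [str_apply, map_add, map_smul, add_apply, smul_apply, smul_eq_mul, e1, e2, e3, e4, e5,
    e6, e4', e5', e6']
  ring

end AlmostHypersymplectic

/-! ### Consequences of X₂ = 0 at a point -/

namespace Hypersymplectic

variable {n : ℕ} {E : Type*} [NormedAddCommGroup E] [NormedSpace ℝ E]
  {M : Type*} [TopologicalSpace M] [ChartedSpace E M] [IsManifold 𝓘(ℝ, E) ∞ M]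
  [MulAction SpOne M] {h : Hypersymplectic n E M} {x : M}

/-- In a chart, K_ξ at the centre is the value on ξ of a linear map, the derivative at 1 of the
extended action. -/
theorem fundVF_lin (hperm : h.IsPermutingAction) (x : M) (ξ : ImSplit) :
    fundVF E ξ x = (ξ : SplitQuaternion).imI • fundVF E ImSplit.i x +
      (ξ : SplitQuaternion).imJ • fundVF E ImSplit.s x +
      (ξ : SplitQuaternion).imK • fundVF E ImSplit.t x := by
  obtain ⟨F, H⟩ := hperm.exists_isLocalAction x
  have h1 := IsLocalAction.velocity_lin (F := F) (extChartAt 𝓘(ℝ, E) x x) ξ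
  rw [velocity_self H, velocity_self H, velocity_self H, velocity_self H] at h1
  exact h1

/-- If `X₂ = 0` at `x`, then `K_ξ = 𝕀_ξ X₀`. -/
theorem fundVF_eq_str_X₀ (hperm : h.IsPermutingAction) (hX : ∀ ξ η, h.X₂ ξ η x = 0) (ξ : ImSplit) :
    fundVF E ξ x = h.str ξ x (h.X₀ x) := by
  have hi : fundVF E ImSplit.i x = h.I x (h.X₀ x) := by
    -- This is X₂(i,i) = 0, and inverting I recovers K_i. Only the three diagonal values of X₂ are
    -- needed; s and t have norm-square −1, which flips the sign below.
    have h1 : h.X₀ x = -h.I x (fundVF E ImSplit.i x) := by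
      have h2 := hX ImSplit.i ImSplit.i
      simp only [X₂, X, ImSplit.bform_eq, h.str_i] at h2
      have h3 : (1 : ℝ) • h.X₀ x = -h.I x (fundVF E ImSplit.i x) := by
        have e : (ImSplit.i : SplitQuaternion).imI * (ImSplit.i : SplitQuaternion).imI -
          (ImSplit.i : SplitQuaternion).imJ * (ImSplit.i : SplitQuaternion).imJ -
          (ImSplit.i : SplitQuaternion).imK * (ImSplit.i : SplitQuaternion).imK = 1 := by
          simp [ImSplit.i]
        rw [e] at h2
        rw [← sub_eq_zero, ← neg_eq_zero, ← h2]
        module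
      rwa [one_smul] at h3
    rw [h1, map_neg, h.I_I, neg_neg]
  have hs : fundVF E ImSplit.s x = h.S x (h.X₀ x) := by
    have h1 : h.X₀ x = h.S x (fundVF E ImSplit.s x) := by
      have h2 := hX ImSplit.s ImSplit.s
      simp only [X₂, X, ImSplit.bform_eq, h.str_s] at h2
      have e : (ImSplit.s : SplitQuaternion).imI * (ImSplit.s : SplitQuaternion).imI -
        (ImSplit.s : SplitQuaternion).imJ * (ImSplit.s : SplitQuaternion).imJ -
        (ImSplit.s : SplitQuaternion).imK * (ImSplit.s : SplitQuaternion).imK = -1 := by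
        simp [ImSplit.s]
      rw [e] at h2
      rw [← sub_eq_zero, ← h2]
      module
    rw [h1, h.S_S]
  have ht : fundVF E ImSplit.t x = h.T x (h.X₀ x) := by
    have h1 : h.X₀ x = h.T x (fundVF E ImSplit.t x) := by
      have h2 := hX ImSplit.t ImSplit.t
      simp only [X₂, X, ImSplit.bform_eq, h.str_t] at h2
      have e : (ImSplit.t : SplitQuaternion).imI * (ImSplit.t : SplitQuaternion).imI -
        (ImSplit.t : SplitQuaternion).imJ * (ImSplit.t : SplitQuaternion).imJ -
        (ImSplit.t : SplitQuaternion).imK * (ImSplit.t : SplitQuaternion).imK = -1 := by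
        simp [ImSplit.t]
      rw [e] at h2
      rw [← sub_eq_zero, ← h2]
      module
    rw [h1, h.T_T]
  rw [fundVF_lin hperm, hi, hs, ht, h.str_apply]

theorem X_eq (hperm : h.IsPermutingAction) (hX : ∀ ξ η, h.X₂ ξ η x = 0) (ξ η : ImSplit) :
    h.X ξ η x = h.str ξ x (h.str η x (h.X₀ x)) := by
  rw [X, fundVF_eq_str_X₀ hperm hX]

/-- If `X₂ = 0` at `x`, then `γ₁(ζ) = (1/2) g(𝕀_ζ X₀, ·)`. -/
theorem γ₁_apply_eq (hperm : h.IsPermutingAction) (hX : ∀ ξ η, h.X₂ ξ η x = 0) (ζ : ImSplit)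
    (u : TangentSpace 𝓘(ℝ, E) x) :
    h.γ₁ ζ x u = 1 / 2 * h.g x (h.str ζ x (h.X₀ x)) u := by
  -- Distinct units anticommute, so antisymmetrising 𝕀_ξ 𝕀_η X₀ loses nothing: for instance ST − TS
  -- = −2I, and the sign in γ₁ for the pair (s,t) absorbs the minus.
  simp only [γ₁, altγ, γ, X_eq hperm hX, h.str_i, h.str_s, h.str_t, h.S_T, h.T_S, h.T_I, h.I_T,
    h.I_S, h.S_I, h.str_apply ζ, add_apply, neg_apply, smul_apply, sub_apply, map_neg, map_add,
    map_smul, smul_eq_mul]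
  ring

/-- Combine γ₁(ξ) = ½ g(𝕀_ξ X₀, ·) with K_η = 𝕀_η X₀. As a multiple of ⟨ξ,η⟩, ρ has no trace-free
part. -/
theorem ρ_eq (hperm : h.IsPermutingAction) (hX : ∀ ξ η, h.X₂ ξ η x = 0) (ξ η : ImSplit) :
    h.ρ ξ η x = 1 / 2 * (ImSplit.bform ξ η * h.g x (h.X₀ x) (h.X₀ x)) := by
  rw [ρ, γ₁_apply_eq hperm hX, fundVF_eq_str_X₀ hperm hX, h.g_str_str]

theorem ρ₀_eq (hperm : h.IsPermutingAction) (hX : ∀ ξ η, h.X₂ ξ η x = 0) :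
    h.ρ₀ x = 1 / 2 * h.g x (h.X₀ x) (h.X₀ x) := by
  simp only [ρ₀, ImSplit.tr, ρ_eq hperm hX, ImSplit.bform_eq]
  simp [ImSplit.i, ImSplit.s, ImSplit.t]
  ring

theorem ρ₂_eq_zero (hperm : h.IsPermutingAction) (hX : ∀ ξ η, h.X₂ ξ η x = 0) (ξ η : ImSplit) :
    h.ρ₂ ξ η x = 0 := by
  rw [ρ₂, ρ_eq hperm hX, ρ_eq hperm hX, ρ₀_eq hperm hX, ImSplit.bform_eq, ImSplit.bform_eq]
  ring

/-! ### The differentials of `ρ₀` and `ρ₂` -/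

variable [FiniteDimensional ℝ E]

theorem IsPermutingAction.contMDiff_ρ₀ (hperm : h.IsPermutingAction) :
    ContMDiff 𝓘(ℝ, E) 𝓘(ℝ, ℝ) ∞ h.ρ₀ :=
  contMDiff_const.mul (((hperm.contMDiff_ρ _ _).sub (hperm.contMDiff_ρ _ _)).sub
    (hperm.contMDiff_ρ _ _))

/-- `d ρ₀ = g(X₀, ·)`. -/
theorem IsPermutingAction.hasMFDerivAt_ρ₀ (hperm : h.IsPermutingAction) (x : M) :
    HasMFDerivAt 𝓘(ℝ, E) 𝓘(ℝ, ℝ) h.ρ₀ x (show E →L[ℝ] ℝ from h.g x (h.X₀ x)) := by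
  have h1 := (((hperm.hasMFDerivAt_ρ ImSplit.i ImSplit.i x).sub
    (hperm.hasMFDerivAt_ρ ImSplit.s ImSplit.s x)).sub
    (hperm.hasMFDerivAt_ρ ImSplit.t ImSplit.t x)).const_smul (1 / 3 : ℝ)
  refine h1.congr_mfderiv (ContinuousLinearMap.ext fun u => ?_)
  have h2 : ∀ u : TangentSpace 𝓘(ℝ, E) x, (1 / 3 : ℝ) *
      ((-h.γ ImSplit.i ImSplit.i x u - h.γ ImSplit.i ImSplit.i x u) -
      (-h.γ ImSplit.s ImSplit.s x u - h.γ ImSplit.s ImSplit.s x u) -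
      (-h.γ ImSplit.t ImSplit.t x u - h.γ ImSplit.t ImSplit.t x u)) = h.g x (h.X₀ x) u := by
    intro u
    simp only [γ, X₀, ImSplit.tr, map_smul, map_sub, smul_apply, sub_apply, smul_eq_mul]
    ring
  exact h2 u

/-- `d ρ₂(ξ, η) = g(X₂(ξ, η), ·)`. -/
theorem IsPermutingAction.hasMFDerivAt_ρ₂ (hperm : h.IsPermutingAction) (ξ η : ImSplit) (x : M) :
    HasMFDerivAt 𝓘(ℝ, E) 𝓘(ℝ, ℝ) (h.ρ₂ ξ η) x (show E →L[ℝ] ℝ from h.g x (h.X₂ ξ η x)) := by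
  have h1 := (((hperm.hasMFDerivAt_ρ ξ η x).add (hperm.hasMFDerivAt_ρ η ξ x)).const_smul
    (1 / 2 : ℝ)).sub ((hperm.hasMFDerivAt_ρ₀ x).const_smul (ImSplit.bform ξ η))
  refine h1.congr_mfderiv (ContinuousLinearMap.ext fun u => ?_)
  have h2 : ∀ u : TangentSpace 𝓘(ℝ, E) x, (1 / 2 : ℝ) *
      ((-h.γ ξ η x u - h.γ η ξ x u) + (-h.γ η ξ x u - h.γ ξ η x u)) -
      ImSplit.bform ξ η * h.g x (h.X₀ x) u = h.g x (h.X₂ ξ η x) u := by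
    intro u
    simp only [γ, X₂, map_smul, map_sub, map_add, map_neg, smul_apply, sub_apply, add_apply,
      neg_apply, smul_eq_mul]
    ring
  exact h2 u

/-- A function vanishing identically has zero differential, and g is nondegenerate. Unlike the
converse, this direction needs ρ₂ to vanish around the point. -/
theorem IsPermutingAction.X₂_eq_zero (hperm : h.IsPermutingAction)
    (hρ : ∀ ξ η x, h.ρ₂ ξ η x = 0) (ξ η : ImSplit) (x : M) : h.X₂ ξ η x = 0 := by
  have h0 : h.ρ₂ ξ η = fun _ => (0 : ℝ) := funext (hρ ξ η)
  have h1 := hperm.hasMFDerivAt_ρ₂ ξ η x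
  rw [h0] at h1
  have h2 := hasMFDerivAt_unique h1 (hasMFDerivAt_const (0 : ℝ) x)
  exact h.eq_zero_of_forall_g_eq_zero fun v => congrArg (fun L : E →L[ℝ] ℝ => L v) h2

/-- From dρ₀ = g(X₀, ·) and skewness of g(J·, ·), J dρ₀ = −g(X₀, J·) = g(J X₀, ·) = 2γ₁(ξ), and
γ₁(ξ) is a primitive of ω_ξ. -/
theorem IsPermutingAction.isPotentialFor (hperm : h.IsPermutingAction)
    (hX : ∀ ξ η x, h.X₂ ξ η x = 0) (ξ : ImSplit)
    {J : ∀ x : M, TangentSpace 𝓘(ℝ, E) x →L[ℝ] TangentSpace 𝓘(ℝ, E) x}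
    (hJ : ∀ x, h.str ξ x = J x) : IsPotentialFor J (h.fundForm ξ) h.ρ₀ := by
  refine ⟨hperm.contMDiff_ρ₀, fun x => ?_⟩
  have h1 : (fun y : M =>
      ContinuousAlternatingMap.ofSubsingleton ℝ (TangentSpace 𝓘(ℝ, E) y) ℝ (0 : Fin 1)
      (-((show TangentSpace 𝓘(ℝ, E) y →L[ℝ] ℝ from mfderiv 𝓘(ℝ, E) 𝓘(ℝ, ℝ) h.ρ₀ y).comp (J y)))) =
      fun y : M => (2 : ℝ) • ContinuousAlternatingMap.ofSubsingleton ℝ (TangentSpace 𝓘(ℝ, E) y) ℝ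
        (0 : Fin 1) (h.γ₁ ξ y) := by
    funext y
    refine ContinuousAlternatingMap.ext fun v => ?_
    have h2 : -h.g y (h.X₀ y) (J y (v 0)) = 2 * h.γ₁ ξ y (v 0) := by
      rw [γ₁_apply_eq hperm (fun ξ η => hX ξ η y), ← hJ, h.symm, h.g_str_skew]
      ring
    refine Eq.trans ?_ h2
    exact congrArg (fun L : E →L[ℝ] ℝ => -L (J y (v 0))) (hperm.hasMFDerivAt_ρ₀ y).mfderiv
  rw [h1, mExtDeriv_smul, smul_smul, ← hperm.mExtDeriv_γ₁ ξ x]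
  norm_num

end Hypersymplectic

end

/-! ### Assembly of the theorem -/

theorem mainTheorem3 {n : ℕ}
    {E : Type*} [NormedAddCommGroup E] [NormedSpace ℝ E] [FiniteDimensional ℝ E]
    {M : Type*} [TopologicalSpace M] [ChartedSpace E M] [IsManifold 𝓘(ℝ, E) ∞ M]
    [MulAction SpOne M] (h : Hypersymplectic n E M)
    (hperm : h.IsPermutingAction)
    (hfree : ∀ (q : SpOne) (x : M), q • x = x → q = 1) :
    ((∀ ξ η x, h.X₂ ξ η x = 0) ↔ (∀ ξ η x, h.ρ₂ ξ η x = 0)) ∧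
    ((∀ ξ η x, h.X₂ ξ η x = 0) →
      h.IsHypersymplecticPotential h.ρ₀ ∧
      (∀ (ξ : ImSplit) (x : M), ξ.nsq ≠ 0 →
        h.X₀ x = -((ξ.nsq)⁻¹ • h.str ξ x (Hypersymplectic.fundVF E ξ x))) ∧
      (∀ (ξ : ImSplit) (x : M), ξ.nsq = 1 →
        h.X₀ x = -(h.str ξ x (Hypersymplectic.fundVF E ξ x))) ∧
      (∀ (ξ : ImSplit) (x : M), ξ.nsq = -1 →
        h.X₀ x = h.str ξ x (Hypersymplectic.fundVF E ξ x)) ∧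
      (∀ x : M, h.g x (h.X₀ x) (h.X₀ x) = 2 * h.ρ₀ x) ∧
      (∀ (ξ : ImSplit) (x : M),
        h.g x (Hypersymplectic.fundVF E ξ x) (Hypersymplectic.fundVF E ξ x) =
          2 * ξ.nsq * h.ρ₀ x)) := by
  refine ⟨⟨fun hX ξ η x => Hypersymplectic.ρ₂_eq_zero hperm (fun ξ η => hX ξ η x) ξ η,
    fun hρ ξ η x => hperm.X₂_eq_zero hρ ξ η x⟩, fun hX => ?_⟩
  -- Since K_ξ = 𝕀_ξ X₀, this is 𝕀_ξ² X₀ = −‖ξ‖² X₀; all three formulas for E are read off from it.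
  have hstr : ∀ (ξ : ImSplit) (x : M), h.str ξ x (Hypersymplectic.fundVF E ξ x) =
      -(ξ.nsq • h.X₀ x) := fun ξ x => by
    rw [Hypersymplectic.fundVF_eq_str_X₀ hperm (fun ξ η => hX ξ η x), h.str_str_self]
  refine ⟨⟨hperm.isPotentialFor hX ImSplit.i fun x => ContinuousLinearMap.ext (h.str_i x),
    hperm.isPotentialFor hX ImSplit.s fun x => ContinuousLinearMap.ext (h.str_s x),
    hperm.isPotentialFor hX ImSplit.t fun x => ContinuousLinearMap.ext (h.str_t x)⟩,
    fun ξ x hξ => ?_, fun ξ x hξ => ?_, fun ξ x hξ => ?_, fun x => ?_, fun ξ x => ?_⟩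
  · rw [hstr, smul_neg, neg_neg, inv_smul_smul₀ hξ]
  · rw [hstr, hξ, one_smul, neg_neg]
  · rw [hstr, hξ, neg_smul, one_smul, neg_neg]
  · rw [Hypersymplectic.ρ₀_eq hperm (fun ξ η => hX ξ η x)]
    ring
  · rw [Hypersymplectic.fundVF_eq_str_X₀ hperm (fun ξ η => hX ξ η x), h.g_str_str,
      Hypersymplectic.ρ₀_eq hperm (fun ξ η => hX ξ η x), ImSplit.nsq_eq]
    ring
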